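/- **Setting.** Let $G$ be a finite multigraph with $m$ edges, each of length $1$ (so $\mathrm{len}(X)=|X|$ for a set $X$ of edges), whose edges carry distinct, linearly ordered IDs, and let $\mathcal D$ be a set of unordered pairs of vertices (demands). A *solution* is a set $F$ of edges of $G$ that connects the two ends of every demand. For a set $C$ of edges, $V(C)$ is the set of vertices incident to an edge of $C$, and $\partial C$ is the set of vertices $v$ such that $C$ contains a proper nonempty subset of the edges incident to $v$. A *branch decomposition* $\mathcal C$ of $G$ is a maximal family of nonempty, pairwise noncrossing (nested or disjoint) sets of edges, called *clusters*; the children of a cluster are the maximal clusters properly contained in it. Let $w\ge 1$ be an integer and suppose that $|\partial C|\le 2w$ for every $C\in\mathcal C$ and that every edge lies in at most $3\log_2 m+1$ clusters. Let $\alpha,\beta>0$ and $\gamma\ge 1/2$ be real numbers. **Contractions.** For a graph $H$, a set $S$ of vertices and an integer $k\ge 0$, $SP(H,S,k)$ is the set of edges of the shortest-path forest of $H$ rooted at $S$ (the edge entering a vertex is the one of smallest ID that ends a shortest path from $S$ to it) that lie on a path of length at most $k$ starting at $S$. Define bottom-up, for each cluster $C$: $A^C=\bigcup_{C_i\text{ child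 of }C}B^{C_i}$, $\rho^C=\max\{\rho\in\mathbb Z_{\ge 0}:\ \mathrm{len}(SP(C/A^C,\partial C,\rho))\ge\alpha\rho\}$ and $B^C=SP(C/A^C,\partial C,\rho^C)\cup A^C$. **Active vertices and regions.** With respect to $C$, a vertex $u\in V(C)$ is *active* if $u\in\partial C$ or there is a demand $\{u,v\}$ with $v\notin V(C)-\partial C$; $\mathrm{act}(C)$ is the set of active vertices. Let $2^{\mu^C}$ be the least element of $\{1,2,4,\dots\}$ that is greater than $\mathrm{dist}_{C/B^C}(u,\partial C)$ for every $u\in\mathrm{act}(C)$. For each cluster $C$ and each integer $i\le\mu^C$ fix any family $\mathcal L^C_i$ of vertex sets of $C/B^C$ (*regions*), each of diameter at most $\beta 2^i$ in $C/B^C$, that together cover all vertices of $C/B^C$ at distance at most $2^i$ from $\partial C$. **Configurations.** For partitions, $\vee$ denotes the finest common coarsening (a partition or subpartition of a subset is extended by singletons). A *configuration* of $C$ is a triple $(\pi^{in},\pi^{out},\pi^{all})$, where $\pi^{in},\pi^{out}$ are partitions of $\partial C$ and $\pi^{all}$ is a partition of $\mathrm{act}(C)$ with $\pi^{all}|_{\partial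 C}=\pi^{in}\vee\pi^{out}$. In the *canonical configuration* of $C$ for a set $F$ of edges, $\pi^{in}$, $\pi^{out}$ and $\pi^{all}$ are the connectivity of $\partial C$ in $F\cap C$, of $\partial C$ in $F-C$, and of $\mathrm{act}(C)$ in $F$, respectively. A configuration of $C$ is *simple* if there are an integer $0\le d\le|\partial C|$, integers $i_1,\dots,i_d$ with $2^{i_j}\in[2^{\mu^C}/(2\gamma),\,2^{\mu^C}]$, and sets $\mathcal Q_j\subseteq\mathcal L^C_{i_j}$ such that $$\pi^{all}=\pi^{in}\vee\pi^{out}\vee P,\qquad P=(P_1,\dots,P_d),\qquad P_j=\Bigl(\mathrm{act}(C)\cap\mathrm{Uncontract}\bigl(\textstyle\bigcup_{Q\in\mathcal Q_j}Q\bigr)\Bigr)-\bigcup_{\ell<j}P_\ell,$$ where $\mathrm{Uncontract}$ maps a set of vertices of $C/B^C$ to the set of vertices contracted to them. **Theorem.** For every solution $F$ there is a solution $F'\supseteq F$, which is a forest if $F$ is a forest, such that for every cluster $C\in\mathcal C$ the canonical configuration of $C$ for $F'$ is simple, and $$\mathrm{len}(F')\le \mathrm{len}(F)+4\beta(2w-1)\Bigl(1+\frac{3\log_2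 m+1}{\gamma}\Bigr)\mathrm{len}(F)+2\alpha^{-1}(2w-1)\,\mathrm{len}(G).$$ -/

import Mathlib

open scoped Graph

namespace SteinerForest

/-! ### Multigraphs, connectivity, contraction, shortest paths -/

section Graphs

variable {V E : Type*}

/-- Connectivity in the subgraph of `G` with edge set `F`, as an equivalence relation on vertices. -/
def conn (G : Graph V E) (F : Set E) : Setoid V :=
  Relation.EqvGen.setoid fun x y => ∃ e ∈ F, G.IsLink e x y

/-- `V(C)`: the vertices incident to an edge of `C`. -/
def verts (G : Graph V E) (C : Set E) : Set V := {v | ∃ e ∈ C, G.Inc e v}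

/-- The boundary `∂C`: the vertices `v` such that `C` contains a proper nonempty subset of the
edges incident to `v`. -/
def boundary (G : Graph V E) (C : Set E) : Set V :=
  {v | (∃ e ∈ C, G.Inc e v) ∧ ∃ e ∉ C, G.Inc e v}

/-- The vertices that result from contracting the edges of `A`. -/
abbrev CVertex (G : Graph V E) (A : Set E) : Type _ := Quotient (conn G A)

/-- The vertex of the contracted graph to which a vertex is contracted. -/
def toC (G : Graph V E) (A : Set E) (v : V) : CVertex G A := Quotient.mk (conn G A) v

/-- A set of edges, viewed as a subgraph without isolated vertices. -/
def edgeSubgraph (G : Graph V E) (C : Set E) : Graph V E := (G.induce (verts G C)).restrict C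

/-- The multigraph `C / A`. -/
def contracted (G : Graph V E) (C A : Set E) : Graph (CVertex G A) E :=
  ((edgeSubgraph G C).deleteEdges A).map (toC G A)

/-- There is a walk with exactly `n` edges from a vertex of `S` to the given vertex. -/
def HasWalk (H : Graph V E) (S : Set V) : ℕ → V → Prop
  | 0, v => v ∈ S
  | n + 1, v => ∃ u e, HasWalk H S n u ∧ H.IsLink e u v

/-- The distance from a set of vertices to a vertex (unit edge lengths); `⊤` if unreachable. -/
noncomputable def dist (H : Graph V E) (S : Set V) (v : V) : ℕ∞ :=
  ⨅ n ∈ {n : ℕ | HasWalk H S n v}, (n : ℕ∞)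

/-- The vertex is at distance at most `r` from the set `S`. -/
def DistLE (H : Graph V E) (S : Set V) (v : V) (r : ℝ) : Prop :=
  ∃ n : ℕ, (n : ℝ) ≤ r ∧ HasWalk H S n v

/-- The edge `e` is the edge entering `v` in the shortest-path forest rooted at `S`: it is the
edge of smallest ID that is the last edge of a shortest `S`-to-`v` path. -/
def IsParentEdge [LinearOrder E] (H : Graph V E) (S : Set V) (e : E) (v : V) : Prop :=
  dist H S v ≠ ⊤ ∧
  (∃ u, H.IsLink e u v ∧ dist H S u + 1 = dist H S v) ∧
  ∀ e' u', H.IsLink e' u' v → dist H S u' + 1 = dist H S v → e ≤ e'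

/-- `SP(H, S, k)`: the edges of the shortest-path forest of `H` rooted at `S` (ties broken by edge
ID) that lie on a path of length at most `k` starting at `S`. -/
def shortestPathForest [LinearOrder E] (H : Graph V E) (S : Set V) (k : ℕ) : Set E :=
  {e | ∃ v, IsParentEdge H S e v ∧ dist H S v ≤ k}

/-- A set of edges is a forest if each of its edges is a bridge of it. -/
def IsForest (G : Graph V E) (F : Set E) : Prop :=
  ∀ e ∈ F, ∀ x y, G.IsLink e x y → ¬ (conn G (F \ {e})) x y

/-- A Steiner forest solution: a set of edges connecting the two ends of each demand. -/
def IsSolution (G : Graph V E) (D : Set (Sym2 V)) (F : Set E) : Prop :=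
  F ⊆ E(G) ∧ ∀ s t, s(s, t) ∈ D → (conn G F) s t

end Graphs

/-! ### Branch decompositions -/

section Decomposition

variable {V E : Type*}

/-- Two sets are noncrossing if they are nested or disjoint. -/
def Noncrossing (A B : Finset E) : Prop := A ⊆ B ∨ B ⊆ A ∨ Disjoint A B

/-- A carving: a maximal family of mutually noncrossing (nonempty, finite) subsets of the
ground set. -/
def IsCarving (ground : Set E) (𝒞 : Set (Finset E)) : Prop :=
  Maximal (fun 𝒟 : Set (Finset E) =>
    (∀ A ∈ 𝒟, A.Nonempty ∧ (A : Set E) ⊆ ground) ∧ ∀ A ∈ 𝒟, ∀ B ∈ 𝒟, Noncrossing A B) 𝒞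

/-- A branch decomposition of `G` is a carving of its edge set. -/
def IsBranchDecomposition (G : Graph V E) (𝒞 : Set (Finset E)) : Prop := IsCarving E(G) 𝒞

/-- `D` is a child of `C` in the Hasse diagram of the clusters. -/
def IsChild (𝒞 : Set (Finset E)) (D C : Finset E) : Prop :=
  D ∈ 𝒞 ∧ D ⊂ C ∧ ∀ D' ∈ 𝒞, D ⊂ D' → ¬ D' ⊂ C

variable [LinearOrder E]

/-- The radius: the maximum `ρ` such that `len(SP(C/A, ∂C, ρ)) ≥ α ρ`. -/
noncomputable def radius (G : Graph V E) (α : ℝ) (C A : Set E) : ℕ :=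
  sSup {ρ : ℕ | α * ρ ≤
    (shortestPathForest (contracted G C A) (toC G A '' boundary G C) ρ).ncard}

/-- The contraction procedure: `B^C = SP(C/A^C, ∂C, ρ^C) ∪ A^C`, where `A^C` is the union of the
sets `B^D` over the children `D` of `C`. -/
noncomputable def contract (G : Graph V E) (𝒞 : Set (Finset E)) (α : ℝ) (C : Finset E) : Set E :=
  let A : Set E := ⋃ D : {D : Finset E // IsChild 𝒞 D C}, contract G 𝒞 α D.1
  shortestPathForest (contracted G C A) (toC G A '' boundary G C) (radius G α C A) ∪ A
termination_by C.card
decreasing_by exact Finset.card_lt_card D.2.2.1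

/-- The graph `C / B^C`. -/
noncomputable abbrev quotientGraph (G : Graph V E) (𝒞 : Set (Finset E)) (α : ℝ) (C : Finset E) :
    Graph (CVertex G (contract G 𝒞 α C)) E :=
  contracted G C (contract G 𝒞 α C)

/-- The boundary `∂C` in `C / B^C`. -/
noncomputable abbrev quotientBoundary (G : Graph V E) (𝒞 : Set (Finset E)) (α : ℝ)
    (C : Finset E) : Set (CVertex G (contract G 𝒞 α C)) :=
  toC G (contract G 𝒞 α C) '' boundary G C

end Decomposition

/-! ### Configurations -/

section Configurations

variable {V E : Type*}

/-- The active vertices of a cluster. -/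
def act (G : Graph V E) (D : Set (Sym2 V)) (C : Set E) : Set V :=
  {u | u ∈ verts G C ∧ (u ∈ boundary G C ∨ ∃ v, s(u, v) ∈ D ∧ v ∉ verts G C \ boundary G C)}

/-- A partition of a set `S` of vertices is represented by the equivalence relation on all vertices
whose classes are the parts and the singletons outside `S`; thus the join `⊔` of equivalence
relations is the finest common coarsening.  `restrictTo r S` is the partition of `S` induced
by `r`. -/
def restrictTo (r : Setoid V) (S : Set V) : Setoid V where
  r x y := x = y ∨ (x ∈ S ∧ y ∈ S ∧ r x y)
  iseqv :=
    { refl := fun _ => Or.inl rfl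
      symm := by
        rintro x y (h | ⟨hx, hy, h⟩)
        · exact Or.inl h.symm
        · exact Or.inr ⟨hy, hx, r.symm h⟩
      trans := by
        rintro x y z (rfl | ⟨hx, hy, h⟩) (rfl | ⟨hy', hz, h'⟩)
        · exact Or.inl rfl
        · exact Or.inr ⟨hy', hz, h'⟩
        · exact Or.inr ⟨hx, hy, h⟩
        · exact Or.inr ⟨hx, hz, r.trans h h'⟩ }

/-- A configuration of a cluster: partitions `pin`, `pout` of `∂C` and a partition `pall` of
`act(C)` whose restriction to `∂C` is the join of `pin` and `pout`. -/
structure Configuration (G : Graph V E) (D : Set (Sym2 V)) (C : Set E) where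
  pin : Setoid V
  pout : Setoid V
  pall : Setoid V
  pin_on : restrictTo pin (boundary G C) = pin
  pout_on : restrictTo pout (boundary G C) = pout
  pall_on : restrictTo pall (act G D C) = pall
  pall_boundary : restrictTo pall (boundary G C) = pin ⊔ pout

theorem restrictTo_restrictTo (r : Setoid V) (S : Set V) :
    restrictTo (restrictTo r S) S = restrictTo r S := by
  ext x y
  constructor
  · rintro (h | ⟨hx, hy, h | ⟨-, -, h⟩⟩)
    · exact Or.inl h
    · exact Or.inl h
    · exact Or.inr ⟨hx, hy, h⟩
  · rintro (h | ⟨hx, hy, h⟩)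
    · exact Or.inl h
    · exact Or.inr ⟨hx, hy, Or.inr ⟨hx, hy, h⟩⟩

theorem conn_mono (G : Graph V E) {F F' : Set E} (h : F ⊆ F') {x y : V} (hxy : (conn G F) x y) :
    (conn G F') x y :=
  Relation.EqvGen.mono (fun _ _ ⟨e, he, hl⟩ => ⟨e, h he, hl⟩) x y hxy

theorem conn_eq_or (G : Graph V E) {F : Set E} {x y : V} (hxy : (conn G F) x y) :
    x = y ∨ (∃ e ∈ F, G.Inc e x) ∧ ∃ e ∈ F, G.Inc e y := by
  change Relation.EqvGen _ x y at hxy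
  induction hxy with
  | rel x y h =>
    obtain ⟨e, he, hl⟩ := h
    exact Or.inr ⟨⟨e, he, hl.inc_left⟩, ⟨e, he, hl.inc_right⟩⟩
  | refl x => exact Or.inl rfl
  | symm x y _ ih =>
    rcases ih with h | ⟨h, h'⟩
    · exact Or.inl h.symm
    · exact Or.inr ⟨h', h⟩
  | trans x y z _ _ ih ih' =>
    rcases ih with rfl | ⟨h, h'⟩
    · exact ih'
    · rcases ih' with rfl | ⟨-, k⟩
      · exact Or.inr ⟨h, h'⟩
      · exact Or.inr ⟨h, k⟩

theorem conn_link (G : Graph V E) {F : Set E} {e : E} {x y : V} (he : e ∈ F)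
    (h : G.IsLink e x y) : (conn G F) x y :=
  Relation.EqvGen.rel _ _ ⟨e, he, h⟩

theorem canonical_aux (G : Graph V E) (F C : Set E) {x y : V} (hx : x ∈ boundary G C)
    (hy : y ∈ boundary G C) (hxy : (conn G F) x y) :
    (restrictTo (conn G (F ∩ C)) (boundary G C) ⊔
      restrictTo (conn G (F \ C)) (boundary G C)) x y := by
  set J := restrictTo (conn G (F ∩ C)) (boundary G C) ⊔
      restrictTo (conn G (F \ C)) (boundary G C) with hJ
  have hin : ∀ {a b : V}, a ∈ boundary G C → b ∈ boundary G C → (conn G (F ∩ C)) a b → J a b :=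
    fun ha hb h => (le_sup_left : _ ≤ J) (Or.inr ⟨ha, hb, h⟩)
  have hout : ∀ {a b : V}, a ∈ boundary G C → b ∈ boundary G C → (conn G (F \ C)) a b → J a b :=
    fun ha hb h => (le_sup_right : _ ≤ J) (Or.inr ⟨ha, hb, h⟩)
  let P : V → Prop := fun z => ∃ b ∈ boundary G C, J x b ∧
    ((conn G (F ∩ C)) b z ∨ (conn G (F \ C)) b z)
  have step : ∀ z z', (∃ e ∈ F, G.IsLink e z z') → P z → P z' := by
    rintro z z' ⟨e, he, hl⟩ ⟨b, hb, hxb, hbz⟩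
    by_cases heC : e ∈ C
    · have hl' : (conn G (F ∩ C)) z z' := conn_link G ⟨he, heC⟩ hl
      rcases hbz with h | h
      · exact ⟨b, hb, hxb, Or.inl (Setoid.trans' _ h hl')⟩
      · rcases conn_eq_or G h with rfl | ⟨-, e', he', hi⟩
        · exact ⟨b, hb, hxb, Or.inl hl'⟩
        · have hz : z ∈ boundary G C := ⟨⟨e, heC, hl.inc_left⟩, ⟨e', he'.2, hi⟩⟩
          exact ⟨z, hz, Setoid.trans' _ hxb (hout hb hz h), Or.inl hl'⟩
    · have hl' : (conn G (F \ C)) z z' := conn_link G ⟨he, heC⟩ hl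
      rcases hbz with h | h
      · rcases conn_eq_or G h with rfl | ⟨-, e', he', hi⟩
        · exact ⟨b, hb, hxb, Or.inr hl'⟩
        · have hz : z ∈ boundary G C := ⟨⟨e', he'.2, hi⟩, ⟨e, heC, hl.inc_left⟩⟩
          exact ⟨z, hz, Setoid.trans' _ hxb (hin hb hz h), Or.inr hl'⟩
      · exact ⟨b, hb, hxb, Or.inr (Setoid.trans' _ h hl')⟩
  have key : ∀ z z', Relation.EqvGen (fun x y => ∃ e ∈ F, G.IsLink e x y) z z' →
      (P z ↔ P z') := by
    intro z z' h
    induction h with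
    | rel a b h =>
      exact ⟨step a b h, step b a (h.imp fun e he => ⟨he.1, he.2.symm⟩)⟩
    | refl a => exact Iff.rfl
    | symm a b _ ih => exact ih.symm
    | trans a b c _ _ ih ih' => exact ih.trans ih'
  obtain ⟨b, hb, hxb, h | h⟩ :=
    (key x y hxy).1 ⟨x, hx, Setoid.refl' _ x, Or.inl (Setoid.refl' _ x)⟩
  · exact Setoid.trans' _ hxb (hin hb hy h)
  · exact Setoid.trans' _ hxb (hout hb hy h)

theorem boundary_subset_act (G : Graph V E) (D : Set (Sym2 V)) (C : Set E) :
    boundary G C ⊆ act G D C := fun _ hv => ⟨hv.1, Or.inl hv⟩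

/-- The canonical configuration of the cluster `C` for a subgraph `F`. -/
def canonicalConfiguration (G : Graph V E) (D : Set (Sym2 V)) (F C : Set E) :
    Configuration G D C where
  pin := restrictTo (conn G (F ∩ C)) (boundary G C)
  pout := restrictTo (conn G (F \ C)) (boundary G C)
  pall := restrictTo (conn G F) (act G D C)
  pin_on := restrictTo_restrictTo _ _
  pout_on := restrictTo_restrictTo _ _
  pall_on := restrictTo_restrictTo _ _
  pall_boundary := by
    apply le_antisymm
    · rintro x y (rfl | ⟨hx, hy, rfl | ⟨-, -, h⟩⟩)
      · exact Setoid.refl' _ _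
      · exact Setoid.refl' _ _
      · exact canonical_aux G F C hx hy h
    · apply sup_le
      · rintro x y (h | ⟨hx, hy, h⟩)
        · exact Or.inl h
        · exact Or.inr ⟨hx, hy, Or.inr ⟨boundary_subset_act G D C hx,
            boundary_subset_act G D C hy, conn_mono G Set.inter_subset_left h⟩⟩
      · rintro x y (h | ⟨hx, hy, h⟩)
        · exact Or.inl h
        · exact Or.inr ⟨hx, hy, Or.inr ⟨boundary_subset_act G D C hx,
            boundary_subset_act G D C hy, conn_mono G Set.sdiff_subset h⟩⟩

end Configurations

/-! ### Regions and simple configurations -/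

section Simple

variable {V E : Type*}

/-- `L` is a covering at scale `2 ^ i` of the vertices of `H` near `S`: every region has diameter at
most `β 2 ^ i`, and the regions together cover the vertices at distance at most `2 ^ i`
from `S`. -/
structure IsCovering (H : Graph V E) (S : Set V) (β : ℝ) (i : ℤ) (L : Set (Set V)) : Prop where
  subset : ∀ Q ∈ L, Q ⊆ V(H)
  diam : ∀ Q ∈ L, ∀ x ∈ Q, ∀ y ∈ Q, DistLE H {x} y (β * 2 ^ i)
  cover : ∀ v, DistLE H S v (2 ^ i) → ∃ Q ∈ L, v ∈ Q

/-- The partition whose nontrivial classes are the given (pairwise disjoint) parts. -/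
def partsSetoid {ι : Type*} (P : ι → Set V) : Setoid V :=
  Relation.EqvGen.setoid fun x y => ∃ j, x ∈ P j ∧ y ∈ P j

variable [LinearOrder E]

/-- `μ^C`: `2 ^ μ^C` is the least power of two in `{1, 2, 4, …}` greater than the distance in
`C / B^C` from `∂C` to each active vertex. -/
noncomputable def mu (G : Graph V E) (D : Set (Sym2 V)) (𝒞 : Set (Finset E)) (α : ℝ)
    (C : Finset E) : ℕ :=
  sInf {n : ℕ | ∀ u ∈ act G D C,
    dist (quotientGraph G 𝒞 α C) (quotientBoundary G 𝒞 α C) (toC G (contract G 𝒞 α C) u) <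
      ((2 ^ n : ℕ) : ℕ∞)}

/-- `Uncontract`: the vertices of `G` that are contracted to vertices in `R`. -/
def uncontract (G : Graph V E) (A : Set E) (R : Set (CVertex G A)) : Set V := toC G A ⁻¹' R

/-- The greedy parts: the `j`-th part consists of the active vertices in the uncontracted regions of
`Q j` that are not already in an earlier part, equivalently not already in uncontracted regions of
`Q l` for some `l < j`. -/
def greedyPart (G : Graph V E) (D : Set (Sym2 V)) (C A : Set E) {d : ℕ}
    (Q : Fin d → Set (Set (CVertex G A))) (j : Fin d) : Set V :=
  (act G D C ∩ uncontract G A (⋃₀ Q j)) \ ⋃ l : {l : Fin d // l < j}, uncontract G A (⋃₀ Q l)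

/-- Simple configurations, with respect to a family of regions at each scale. -/
def IsSimple (G : Graph V E) (D : Set (Sym2 V)) (𝒞 : Set (Finset E)) (α γ : ℝ) (C : Finset E)
    (L : ℤ → Set (Set (CVertex G (contract G 𝒞 α C)))) (π : Configuration G D C) : Prop :=
  ∃ d : ℕ, d ≤ (boundary G C).ncard ∧
  ∃ i : Fin d → ℤ,
    (∀ j, (2 : ℝ) ^ mu G D 𝒞 α C / (2 * γ) ≤ 2 ^ i j ∧ (2 : ℝ) ^ i j ≤ 2 ^ mu G D 𝒞 α C) ∧
  ∃ Q : Fin d → Set (Set (CVertex G (contract G 𝒞 α C))),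
    (∀ j, Q j ⊆ L (i j)) ∧
    π.pall = π.pin ⊔ π.pout ⊔ partsSetoid (greedyPart G D C (contract G 𝒞 α C) Q)

end Simple

end SteinerForest

/-! The clusters are treated from large to small. The current edge set W contains F, and the edges
contracted in the clusters still to be treated (pending edges) count as available for free. At a
cluster C, the edges of B^C are therefore all available, so joining two vertices of one region of
scale i costs at most β2^i.

Give each class of active vertices of C the scale of its active vertex farthest from ∂C, but at
least the least admissible scale. As long as a region at the scale of one class also contains an
active vertex of another class of the same or a larger scale, join the two. When this stops,
ordering the classes by scale makes the greedy parts exactly the classes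
(`regionsCapture_of_stable`). Every active vertex is joined by F to ∂C inside C, so at most |∂C| - 1
joins occur. Capture by fixed regions survives later coarsening of the connectivity, so work on
smaller clusters does no harm.

Joins are paid for in two ways. At the least scale, 2^i ≤ 2^μ/γ ≤ 2|F ∩ C|/γ; summing over clusters
uses the bound on the number of clusters containing an edge. At a larger scale, both classes contain
a vertex whose component in F has at least 2^(i-1) edges, and such a component is charged.
`IsCharging` keeps an uncharged component at least as large for every vertex, so each component of F
is charged at most once in the whole process, for a total of 2β|F|.

Finally the edges contracted at C itself cease to be free. Only the connectivity of ∂C matters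
outside C, and `exists_subset_conn` realizes it with at most 2ρ(|∂C| - 1) of them. The newly
contracted sets are disjoint and have at least αρ edges, so the radii sum to at most |E(G)|/α. A
forest containing F and spanning the components of W has the same connectivity as W, hence the same
captured classes. -/

namespace SteinerForest

/-! ### Connectivity, spanning forests and class counts -/

section Connectivity

variable {V E : Type*} {G : Graph V E}

/-- A property preserved along the edges of `F` is preserved by connectivity in `F`. -/
theorem conn_induction {F : Set E} {P : V → Prop}
    (step : ∀ e ∈ F, ∀ a b, G.IsLink e a b → P a → P b) {x y : V} (h : conn G F x y)
    (hx : P x) : P y := by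
  have key : ∀ z z', Relation.EqvGen (fun x y => ∃ e ∈ F, G.IsLink e x y) z z' →
      (P z ↔ P z') := by
    intro z z' h
    induction h with
    | rel a b h =>
      obtain ⟨e, he, hl⟩ := h
      exact ⟨step e he a b hl, step e he b a hl.symm⟩
    | refl a => exact Iff.rfl
    | symm a b _ ih => exact ih.symm
    | trans a b c _ _ ih ih' => exact ih.trans ih'
  exact (key x y h).1 hx

theorem conn_refl (F : Set E) (x : V) : conn G F x x := Setoid.refl' _ x

theorem conn_symm {F : Set E} {x y : V} (h : conn G F x y) : conn G F y x := Setoid.symm' _ h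

theorem conn_trans {F : Set E} {x y z : V} (h : conn G F x y) (h' : conn G F y z) :
    conn G F x z := Setoid.trans' _ h h'

theorem conn_insert_cases {X : Set E} {e : E} {a b x y : V} (hl : G.IsLink e a b)
    (h : conn G (insert e X) x y) :
    conn G X x y ∨ (conn G X x a ∧ conn G X b y) ∨ (conn G X x b ∧ conn G X a y) := by
  refine conn_induction (F := insert e X) (P := fun z => conn G X x z ∨
    (conn G X x a ∧ conn G X b z) ∨ (conn G X x b ∧ conn G X a z)) ?_ h
    (Or.inl (conn_refl _ _))
  rintro f (rfl | hf) p q hpq hp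
  · rcases hl.eq_and_eq_or_eq_and_eq hpq with ⟨rfl, rfl⟩ | ⟨rfl, rfl⟩
    · rcases hp with hp | ⟨hp, -⟩ | ⟨hp, -⟩
      · exact Or.inr (Or.inl ⟨hp, conn_refl _ _⟩)
      · exact Or.inr (Or.inl ⟨hp, conn_refl _ _⟩)
      · exact Or.inl hp
    · rcases hp with hp | ⟨hp, -⟩ | ⟨hp, -⟩
      · exact Or.inr (Or.inr ⟨hp, conn_refl _ _⟩)
      · exact Or.inl hp
      · exact Or.inr (Or.inr ⟨hp, conn_refl _ _⟩)
  · have := conn_link G hf hpq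
    exact hp.imp (conn_trans · this)
      (Or.imp (And.imp_right (conn_trans · this)) (And.imp_right (conn_trans · this)))

/-- A forest in a finite set `X` of edges extends to a spanning forest of `X`. -/
theorem exists_forest_conn_eq {F X : Set E} (hX : X.Finite) (hFX : F ⊆ X)
    (hF : IsForest G F) : ∃ F', F ⊆ F' ∧ F' ⊆ X ∧ IsForest G F' ∧ conn G F' = conn G X := by
  have hfin : {Y : Set E | F ⊆ Y ∧ Y ⊆ X ∧ IsForest G Y}.Finite :=
    hX.finite_subsets.subset fun Y hY => hY.2.1
  obtain ⟨Y, hY⟩ := hfin.exists_maximal ⟨F, subset_rfl, hFX, hF⟩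
  obtain ⟨⟨hFY, hYX, hYF⟩, hmax⟩ := hY
  refine ⟨Y, hFY, hYX, hYF, le_antisymm (fun x y h => conn_mono G hYX h) fun x y h => ?_⟩
  refine conn_induction (P := fun z => conn G Y x z) ?_ h (conn_refl _ _)
  intro e he a b hl hx
  refine conn_trans hx ?_
  by_contra hab
  have heY : e ∉ Y := fun h => hab (conn_link G h hl)
  -- An edge joining two components of `Y` contradicts maximality. A cycle through `f` in the
  -- enlarged set would either avoid `e`, although `Y` is a forest, or pass through `e` and so join
  -- `a` to `b` inside `Y`.
  refine heY (hmax (y := insert e Y) ⟨hFY.trans (Set.subset_insert _ _),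
    Set.insert_subset he hYX, ?_⟩ (Set.subset_insert _ _) (Set.mem_insert _ _))
  intro f hf p q hpq hcon
  by_cases hfe : f = e
  · subst hfe
    rw [Set.insert_sdiff_self_of_notMem heY] at hcon
    rcases hl.eq_and_eq_or_eq_and_eq hpq with ⟨rfl, rfl⟩ | ⟨rfl, rfl⟩
    · exact hab hcon
    · exact hab (conn_symm hcon)
  · have hfY : f ∈ Y := hf.resolve_left hfe
    have hsub : insert e Y \ {f} ⊆ insert e (Y \ {f}) := by
      rintro g ⟨rfl | hg, hgf⟩
      · exact Set.mem_insert _ _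
      · exact Set.mem_insert_of_mem _ ⟨hg, hgf⟩
    have hpqY := conn_link G hfY hpq
    have hm : ∀ {s t}, conn G (Y \ {f}) s t → conn G Y s t :=
      fun h => conn_mono G Set.sdiff_subset h
    rcases conn_insert_cases hl (conn_mono G hsub hcon) with h | ⟨h, h'⟩ | ⟨h, h'⟩
    · exact hYF f hfY p q hpq h
    · exact hab (conn_trans (conn_symm (hm h)) (conn_trans hpqY (conn_symm (hm h'))))
    · exact hab (conn_trans (hm h') (conn_trans (conn_symm hpqY) (hm h)))

theorem verts_finite (G : Graph V E) {C : Set E} (hC : C.Finite) : (verts G C).Finite := by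
  have : verts G C ⊆ ⋃ e ∈ C, {v | G.Inc e v} := by
    rintro v ⟨e, he, hv⟩
    exact Set.mem_biUnion he hv
  refine (hC.biUnion fun e _ => ?_).subset this
  by_cases h : ∃ x y, G.IsLink e x y
  · obtain ⟨x, y, h⟩ := h
    exact ((Set.finite_singleton y).insert x).subset fun v hv => hv.eq_or_eq_of_isLink h
  · convert Set.finite_empty
    ext v
    simp only [Set.mem_ofPred_eq, Set.mem_empty_iff_false, iff_false]
    rintro ⟨y, hy⟩
    exact h ⟨v, y, hy⟩

theorem boundary_finite (G : Graph V E) {C : Set E} (hC : C.Finite) : (boundary G C).Finite :=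
  (verts_finite G hC).subset fun _ h => h.1

/-- The number of classes of `r` that meet `S`. -/
noncomputable def classCount (r : Setoid V) (S : Set V) : ℕ := (Quotient.mk r '' S).ncard

theorem classCount_le {r : Setoid V} {S : Set V} (hS : S.Finite) : classCount r S ≤ S.ncard :=
  Set.ncard_image_le hS

theorem classCount_pos {r : Setoid V} {S : Set V} (hS : S.Finite) (hne : S.Nonempty) :
    0 < classCount r S :=
  (Set.ncard_pos (hS.image _)).2 (hne.image _)

/-- The progress measure of both greedy procedures: each addition merges two classes that meet `S`,
which makes them stop and bounds the number of paid steps. -/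
theorem classCount_lt {r r' : Setoid V} {S : Set V} (hS : S.Finite) (hle : r ≤ r') {a b : V}
    (ha : a ∈ S) (hb : b ∈ S) (hab : ¬ r a b) (hab' : r' a b) :
    classCount r' S < classCount r S := by
  let f : Quotient r → Quotient r' := Quotient.map' id fun _ _ h => hle h
  have himg : f '' (Quotient.mk r '' S) = Quotient.mk r' '' S := by
    rw [Set.image_image]; rfl
  rw [classCount, ← himg]
  refine lt_of_le_of_ne (Set.ncard_image_le (hS.image _)) fun h => hab ?_
  have hinj := Set.injOn_of_ncard_image_eq h (hS.image _)
  exact Quotient.exact (hinj ⟨a, ha, rfl⟩ ⟨b, hb, rfl⟩ (Quotient.sound hab'))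

end Connectivity

/-! ### Walks in contracted graphs versus connectivity in `G` -/

section Contraction

variable {V E : Type*} {G : Graph V E}

theorem toC_eq_iff {A : Set E} {x y : V} : toC G A x = toC G A y ↔ conn G A x y :=
  ⟨fun h => Quotient.exact h, fun h => Quotient.sound h⟩

theorem contracted_isLink {C A : Set E} {e : E} {u v : CVertex G A} :
    (contracted G C A).IsLink e u v ↔
      e ∈ C ∧ e ∉ A ∧ ∃ x y, G.IsLink e x y ∧ toC G A x = u ∧ toC G A y = v := by
  simp only [contracted, edgeSubgraph, Graph.map_isLink, Relation.Map, Graph.deleteEdges_isLink,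
    Graph.restrict_isLink, Graph.induce_isLink]
  constructor
  · rintro ⟨x, y, h, hx, hy⟩
    grind
  · rintro ⟨hC, hA, x, y, h, hx, hy⟩
    have h1 : x ∈ verts G C := ⟨e, hC, h.inc_left⟩
    have h2 : y ∈ verts G C := ⟨e, hC, h.inc_right⟩
    exact ⟨x, y, by grind, hx, hy⟩

theorem dist_le_iff {H : Graph V E} {S : Set V} {v : V} {n : ℕ} :
    dist H S v ≤ n ↔ ∃ k ≤ n, HasWalk H S k v := by
  constructor
  · intro h
    by_contra! hcon
    have : ((n + 1 : ℕ) : ℕ∞) ≤ dist H S v := by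
      refine le_iInf₂ fun k hk => ?_
      have : ¬ k ≤ n := fun hkn => hcon k hkn hk
      exact_mod_cast not_le.1 this
    have := this.trans h
    norm_cast at this
    omega
  · rintro ⟨k, hk, hw⟩
    exact (iInf₂_le k hw).trans (by exact_mod_cast hk)

/-- The edges of a walk in a contracted graph. -/
theorem exists_edges_of_hasWalk {C A : Set E} {S : Set (CVertex G A)} {n : ℕ} {v : CVertex G A}
    (h : HasWalk (contracted G C A) S n v) :
    ∃ s ∈ S, ∃ Y ⊆ C \ A, Y.Finite ∧ Y.ncard ≤ n ∧
      ∀ x y, toC G A x = s → toC G A y = v → conn G (Y ∪ A) x y := by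
  induction n generalizing v with
  | zero =>
    refine ⟨v, h, ∅, Set.empty_subset _, Set.finite_empty, by simp, fun x y hx hy => ?_⟩
    exact conn_mono G Set.subset_union_right (toC_eq_iff.1 (hx.trans hy.symm))
  | succ n ih =>
    obtain ⟨u, e, hu, hl⟩ := h
    obtain ⟨s, hs, Y, hY, hfin, hcard, hconn⟩ := ih hu
    obtain ⟨heC, heA, a, b, hab, rfl, rfl⟩ := contracted_isLink.1 hl
    refine ⟨s, hs, insert e Y, Set.insert_subset ⟨heC, heA⟩ hY, hfin.insert e,
      (Set.ncard_insert_le _ _).trans (by omega), fun x y hx hy => ?_⟩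
    have h1 : conn G (insert e Y ∪ A) x a :=
      conn_mono G (Set.union_subset_union_left _ (Set.subset_insert _ _)) (hconn x a hx rfl)
    have h2 : conn G (insert e Y ∪ A) a b := conn_link G (Or.inl (Set.mem_insert _ _)) hab
    have h3 : conn G (insert e Y ∪ A) b y :=
      conn_mono G Set.subset_union_right (toC_eq_iff.1 hy.symm)
    exact conn_trans h1 (conn_trans h2 h3)

/-- Vertices connected by a finite set of edges are close to each other in contracted graphs. -/
theorem exists_hasWalk_of_conn {C A : Set E} {S : Set (CVertex G A)} {X : Set E}
    (hX : X.Finite) (hXC : X ⊆ C) {x y : V} (h : conn G X x y) (hy : toC G A y ∈ S) :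
    ∃ n ≤ X.ncard, HasWalk (contracted G C A) S n (toC G A x) := by
  induction hn : X.ncard using Nat.strong_induction_on generalizing X x with
  | _ N ih =>
  subst hn
  by_cases hxy : x = y
  · subst hxy
    exact ⟨0, Nat.zero_le _, hy⟩
  obtain ⟨e, he, x', hl, hx'⟩ : ∃ e ∈ X, ∃ x', G.IsLink e x x' ∧ conn G X x' y := by
    have := conn_symm h
    have key : y = x ∨ ∃ e ∈ X, ∃ x', G.IsLink e x x' ∧ conn G X x' y := by
      refine conn_induction (P := fun z => y = z ∨ ∃ e ∈ X, ∃ x', G.IsLink e z x' ∧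
        conn G X x' y) ?_ this (Or.inl rfl)
      rintro e he a b hab (rfl | ⟨f, hf, a', haa', ha'⟩)
      · exact Or.inr ⟨e, he, y, hab.symm, conn_refl _ _⟩
      · exact Or.inr ⟨e, he, a, hab.symm, conn_trans (conn_link G hf haa') ha'⟩
    exact key.resolve_left (Ne.symm hxy)
  have hlt : (X \ {e}).ncard < X.ncard := Set.ncard_sdiff_singleton_lt_of_mem he hX
  have hfin : (X \ {e}).Finite := hX.subset Set.sdiff_subset
  have hsub : X \ {e} ⊆ C := Set.sdiff_subset.trans hXC
  have hins : insert e (X \ {e}) = X := Set.insert_sdiff_self_of_mem he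
  by_cases hcase : conn G (X \ {e}) x y
  · obtain ⟨n, hn, hw⟩ := ih _ hlt hfin hsub hcase rfl
    exact ⟨n, hn.trans hlt.le, hw⟩
  -- If `e` is indispensable for reaching `y` from `x`, then it is not needed again from `x'`, which
  -- lets each edge be counted once.
  · have hx'y : conn G (X \ {e}) x' y := by
      rw [← hins] at hx'
      rcases conn_insert_cases hl hx' with h | ⟨h, h'⟩ | ⟨h, h'⟩
      · exact h
      · exact h'
      · exact absurd h' hcase
    obtain ⟨n, hn, hw⟩ := ih _ hlt hfin hsub hx'y rfl
    -- A contracted edge costs no step: its ends are the same vertex of the quotient.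
    by_cases heA : e ∈ A
    · refine ⟨n, hn.trans hlt.le, ?_⟩
      rwa [toC_eq_iff.2 (conn_link G heA hl)]
    · exact ⟨n + 1, by omega, toC G A x', e, hw,
        contracted_isLink.2 ⟨hXC he, heA, x', x, hl.symm, rfl, rfl⟩⟩

end Contraction

/-! ### Paths inside the shortest-path forest -/

section ShortestPaths

variable {V E : Type*} [LinearOrder E] {G : Graph V E}

theorem shortestPathForest_subset {C A : Set E} {S : Set (CVertex G A)} {k : ℕ} :
    shortestPathForest (contracted G C A) S k ⊆ C \ A := by
  rintro e ⟨v, ⟨-, ⟨u, hl, -⟩, -⟩, -⟩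
  have := contracted_isLink.1 hl
  exact ⟨this.1, this.2.1⟩

/-- Following entering edges back from `v` lowers the distance by one each time, so the path to a
root stays inside the forest of depth `k`. Finiteness of `C` provides the entering edge of smallest
ID. -/
theorem exists_path_shortestPathForest {C A : Set E} (hC : C.Finite) {S : Set (CVertex G A)}
    {k n : ℕ} {v : CVertex G A} (hn : n ≤ k) (hv : dist (contracted G C A) S v = n) :
    ∃ s ∈ S, ∃ X ⊆ shortestPathForest (contracted G C A) S k, X.Finite ∧ X.ncard ≤ n ∧
      ∀ x y, toC G A x = s → toC G A y = v → conn G (X ∪ A) x y := by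
  set H := contracted G C A
  induction n generalizing v with
  | zero =>
    obtain ⟨j, hj, hw⟩ := dist_le_iff.1 hv.le
    obtain rfl : j = 0 := by omega
    refine ⟨v, hw, ∅, Set.empty_subset _, Set.finite_empty, by simp, fun x y hx hy => ?_⟩
    exact conn_mono G Set.subset_union_right (toC_eq_iff.1 (hx.trans hy.symm))
  | succ n ih =>
    have hlow : ∀ j, HasWalk H S j v → n + 1 ≤ j := by
      intro j hj
      have := hv ▸ dist_le_iff.2 ⟨j, le_rfl, hj⟩
      exact_mod_cast this
    obtain ⟨j, hj, hw⟩ := dist_le_iff.1 hv.le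
    obtain rfl : j = n + 1 := le_antisymm hj (hlow j hw)
    obtain ⟨u, e, hu, hl⟩ := hw
    have hdist : ∀ {u e}, HasWalk H S n u → H.IsLink e u v → dist H S u = n := by
      intro u e hu hl
      refine le_antisymm (dist_le_iff.2 ⟨n, le_rfl, hu⟩) ?_
      refine le_iInf₂ fun m hm => ?_
      have := hlow (m + 1) ⟨u, e, hm, hl⟩
      exact_mod_cast Nat.le_of_succ_le_succ this
    set T : Set E := {e | ∃ u, H.IsLink e u v ∧ dist H S u + 1 = dist H S v} with hT
    have hTfin : T.Finite := hC.subset fun e ⟨u, h, _⟩ => (contracted_isLink.1 h).1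
    have hTne : T.Nonempty := ⟨e, u, hl, by rw [hdist hu hl, hv]; norm_cast⟩
    obtain ⟨f, ⟨t, hft, htv⟩, hmin⟩ := Set.exists_min_image T id hTfin hTne
    have hpar : IsParentEdge H S f v :=
      ⟨by rw [hv]; exact ENat.natCast_ne_top _, ⟨t, hft, htv⟩,
        fun e' u' h h' => hmin e' ⟨u', h, h'⟩⟩
    have ht : dist H S t = n := by
      rw [hv] at htv
      push_cast at htv
      exact ENat.add_left_injective_of_ne_top (by simp) htv
    obtain ⟨s, hs, X, hX, hfin, hcard, hconn⟩ := ih (by omega) ht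
    obtain ⟨-, -, a, b, hab, rfl, rfl⟩ := contracted_isLink.1 hft
    refine ⟨s, hs, insert f X, Set.insert_subset ⟨_, hpar, by rw [hv]; exact_mod_cast hn⟩ hX,
      hfin.insert f, (Set.ncard_insert_le _ _).trans (by omega), fun x y hx hy => ?_⟩
    have h1 : conn G (insert f X ∪ A) x a :=
      conn_mono G (Set.union_subset_union_left _ (Set.subset_insert _ _)) (hconn x a hx rfl)
    have h2 : conn G (insert f X ∪ A) a b := conn_link G (Or.inl (Set.mem_insert _ _)) hab
    have h3 : conn G (insert f X ∪ A) b y :=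
      conn_mono G Set.subset_union_right (toC_eq_iff.1 hy.symm)
    exact conn_trans h1 (conn_trans h2 h3)

/-- Both ends of an edge of a shortest-path forest of depth `k` are joined to a common root by at
most `k` edges of the forest. -/
theorem exists_root_of_mem_shortestPathForest {C A : Set E} (hC : C.Finite)
    {S : Set (CVertex G A)} {k : ℕ} {e : E}
    (he : e ∈ shortestPathForest (contracted G C A) S k) :
    ∃ s ∈ S, ∀ z, G.Inc e z → ∃ X ⊆ shortestPathForest (contracted G C A) S k,
      X.Finite ∧ X.ncard ≤ k ∧ ∀ x, toC G A x = s → conn G (X ∪ A) x z := by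
  obtain ⟨v, hpar, hk⟩ := id he
  obtain ⟨hv, ⟨u, hl, huv⟩, -⟩ := hpar
  obtain ⟨n, hn⟩ := ENat.ne_top_iff_exists.1 (show dist (contracted G C A) S u ≠ ⊤ by
    rintro h
    rw [h] at huv
    exact hv (by rw [← huv]; rfl))
  have hnk : n + 1 ≤ k := by
    rw [← huv, ← hn] at hk
    exact_mod_cast hk
  obtain ⟨s, hs, X, hX, hfin, hcard, hconn⟩ :=
    exists_path_shortestPathForest hC (show n ≤ k by omega) hn.symm
  obtain ⟨-, -, a, b, hab, rfl, rfl⟩ := contracted_isLink.1 hl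
  refine ⟨s, hs, fun z hz => ⟨insert e X, Set.insert_subset he hX, hfin.insert e,
    (Set.ncard_insert_le _ _).trans (by omega), fun x hx => ?_⟩⟩
  have h1 : conn G (insert e X ∪ A) x a :=
    conn_mono G (Set.union_subset_union_left _ (Set.subset_insert _ _)) (hconn x a hx rfl)
  rcases hz.eq_or_eq_of_isLink hab with rfl | rfl
  · exact h1
  · exact conn_trans h1 (conn_link G (Or.inl (Set.mem_insert _ _)) hab)

end ShortestPaths

/-! ### Replacing contracted edges by few of them -/

section Fill

variable {V E : Type*} {G : Graph V E}

/-- If the ends of each edge of `T` are joined to a common vertex of `S` by at most `k` edges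
of `T`, then few edges of `T` suffice to preserve the connectivity of `S`. -/
theorem exists_subset_conn {S : Set V} (hS : S.Finite) {T U : Set E} {k : ℕ}
    (hnear : ∀ e ∈ T, ∃ s ∈ S, ∀ z, G.Inc e z →
      ∃ X ⊆ T, X.Finite ∧ X.ncard ≤ k ∧ conn G (X ∪ U) s z) :
    ∃ X ⊆ T, X.Finite ∧ X.ncard ≤ 2 * k * (S.ncard - 1) ∧
      ∀ b ∈ S, ∀ b' ∈ S, conn G (U ∪ T) b b' → conn G (U ∪ X) b b' := by
  let near : V → V → Prop := fun s z => s ∈ S ∧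
    ∃ X ⊆ T, X.Finite ∧ X.ncard ≤ k ∧ conn G (X ∪ U) s z
  -- Amortization: each class of `S` is worth `2 * k` edges. Two root paths of at most `k` edges
  -- each are added only when they merge two classes, so they pay for themselves.
  have main : ∀ N, ∀ X ⊆ T, X.Finite → classCount (conn G (U ∪ X)) S = N →
      X.ncard + 2 * k * N ≤ 2 * k * S.ncard →
      ∃ X ⊆ T, X.Finite ∧
        X.ncard + 2 * k * classCount (conn G (U ∪ X)) S ≤ 2 * k * S.ncard ∧
        ∀ z z' s s', near s z → near s' z' → conn G U z z' → conn G (U ∪ X) s s' := by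
    intro N
    induction N using Nat.strong_induction_on with
    | _ N ih =>
    intro X hXT hXfin hN hcost
    by_cases hsat : ∀ z z' s s', near s z → near s' z' → conn G U z z' → conn G (U ∪ X) s s'
    · exact ⟨X, hXT, hXfin, hN ▸ hcost, hsat⟩
    push Not at hsat
    obtain ⟨z, z', s, s', ⟨hs, X₁, hX₁, hf₁, hc₁, hz⟩, ⟨hs', X₂, hX₂, hf₂, hc₂, hz'⟩, hzz, hn⟩ :=
      hsat
    have hle : U ∪ X ⊆ U ∪ (X ∪ X₁ ∪ X₂) :=
      Set.union_subset_union_right _ (Set.subset_union_left.trans Set.subset_union_left)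
    have hnew : conn G (U ∪ (X ∪ X₁ ∪ X₂)) s s' := by
      refine conn_trans (conn_mono G ?_ hz)
        (conn_trans (conn_mono G ?_ hzz) (conn_symm (conn_mono G ?_ hz')))
      · intro e; simp only [Set.mem_union]; tauto
      · exact Set.subset_union_left
      · intro e; simp only [Set.mem_union]; tauto
    have hlt := classCount_lt hS (fun _ _ h => conn_mono G hle h) hs hs' hn hnew
    refine ih _ (hN ▸ hlt) (X ∪ X₁ ∪ X₂) (Set.union_subset (Set.union_subset hXT hX₁) hX₂)
      ((hXfin.union hf₁).union hf₂) rfl ?_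
    have h1 := Set.ncard_union_le (X ∪ X₁) X₂
    have h2 := Set.ncard_union_le X X₁
    have h3 : 2 * k * (classCount (conn G (U ∪ (X ∪ X₁ ∪ X₂))) S + 1) ≤ 2 * k * N :=
      Nat.mul_le_mul_left _ (by omega)
    rw [Nat.mul_add] at h3
    omega
  obtain ⟨X, hXT, hXfin, hcost, hsat⟩ := main _ ∅ (Set.empty_subset _) Set.finite_empty rfl
    (by simpa using Nat.mul_le_mul_left (2 * k) (classCount_le hS))
  refine ⟨X, hXT, hXfin, ?_, fun b hb b' hb' h => ?_⟩
  -- For empty `S` the truncated `S.ncard - 1` is 0 and the potential already forces `X` to be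
  -- empty; otherwise one class survives, which saves one summand `2 * k`.
  · rcases S.eq_empty_or_nonempty with rfl | hne
    · simp only [Set.ncard_empty, mul_zero] at hcost ⊢
      omega
    · have hpos := classCount_pos (r := conn G (U ∪ X)) hS hne
      have := Nat.mul_le_mul_left (2 * k) hpos
      rw [Nat.mul_sub]
      omega
  · have hself : ∀ {s}, s ∈ S → near s s := fun hs =>
      ⟨hs, ∅, Set.empty_subset _, Set.finite_empty, by simp, conn_refl _ _⟩
    -- Invariant along a path from `b`: the current vertex reaches, by `U` alone, a vertex near a
    -- root that is already joined to `b`. An edge of `T` has a common root for both its ends, so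
    -- saturation restores the invariant after it.
    have key : ∃ z s, near s z ∧ conn G U b' z ∧ conn G (U ∪ X) s b := by
      refine conn_induction (P := fun y => ∃ z s, near s z ∧ conn G U y z ∧ conn G (U ∪ X) s b)
        ?_ h ⟨b, b, hself hb, conn_refl _ _, conn_refl _ _⟩
      rintro e he p q hpq ⟨z, s, hsz, hpz, hsb⟩
      by_cases heU : e ∈ U
      · exact ⟨z, s, hsz, conn_trans (conn_link G heU hpq.symm) hpz, hsb⟩
      · obtain ⟨t, ht, hend⟩ := hnear e (he.resolve_left heU)
        exact ⟨q, t, ⟨ht, hend q hpq.inc_right⟩, conn_refl _ _,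
          conn_trans (hsat p z t s ⟨ht, hend p hpq.inc_left⟩ hsz hpz) hsb⟩
    obtain ⟨z, s, hsz, hz, hsb⟩ := key
    exact conn_symm (conn_trans (hsat b' z b' s (hself hb') hsz hz) hsb)

/-- Connectivity between vertices that are not interior to `C` depends on the edges in `C` only
through the connectivity of the boundary. -/
theorem conn_of_boundary_conn {C T U X : Set E} (hT : T ⊆ C)
    (hb : ∀ b ∈ boundary G C, ∀ b' ∈ boundary G C, conn G (U ∪ T) b b' → conn G (U ∪ X) b b')
    {x y : V} (hx : x ∉ verts G C \ boundary G C) (hy : y ∉ verts G C \ boundary G C)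
    (h : conn G (U ∪ T) x y) : conn G (U ∪ X) x y := by
  -- Either the path has stayed off the interior of `C` with its connectivity already transferred,
  -- or it has met `C` at a boundary vertex. Applying this from both ends leaves only a connection
  -- between two boundary vertices.
  have key : ∀ {x y}, x ∉ verts G C \ boundary G C → conn G (U ∪ T) x y →
      (y ∉ verts G C \ boundary G C ∧ conn G (U ∪ X) x y) ∨
      ∃ b ∈ boundary G C, conn G (U ∪ X) x b ∧ conn G (U ∪ T) b y := by
    intro x y hx h
    refine conn_induction (P := fun y => (y ∉ verts G C \ boundary G C ∧ conn G (U ∪ X) x y) ∨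
      ∃ b ∈ boundary G C, conn G (U ∪ X) x b ∧ conn G (U ∪ T) b y) ?_ h
      (Or.inl ⟨hx, conn_refl _ _⟩)
    rintro e he p q hpq (⟨hp, hxp⟩ | ⟨b, hbC, hxb, hbp⟩)
    · by_cases heC : e ∈ C
      · have hpb : p ∈ boundary G C := by
          by_contra hpb
          exact hp ⟨⟨e, heC, hpq.inc_left⟩, hpb⟩
        exact Or.inr ⟨p, hpb, hxp, conn_link G he hpq⟩
      · have heU : e ∈ U := he.resolve_right fun h => heC (hT h)
        refine Or.inl ⟨fun ⟨hq, hq'⟩ => hq' ⟨hq, e, heC, hpq.inc_right⟩, ?_⟩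
        exact conn_trans hxp (conn_link G (Or.inl heU) hpq)
    · exact Or.inr ⟨b, hbC, hxb, conn_trans hbp (conn_link G he hpq)⟩
  rcases key hx h with h | ⟨b, hbC, hxb, hby⟩
  · exact h.2
  · rcases key hy (conn_symm hby) with h | ⟨b', hbC', hyb, hbb⟩
    · exact conn_trans hxb (conn_symm h.2)
    · exact conn_trans hxb (conn_trans (hb b hbC b' hbC' (conn_symm hbb)) (conn_symm hyb))

end Fill

/-! ### Components of `F` and active vertices -/

section Active

variable {V E : Type*} {G : Graph V E} {D : Set (Sym2 V)} {F : Set E}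

/-- The edges in the component of `F` that contains `u`. -/
def componentEdges (G : Graph V E) (F : Set E) (u : V) : Set E :=
  {e ∈ F | ∃ z, G.Inc e z ∧ conn G F u z}

theorem componentEdges_subset (u : V) : componentEdges G F u ⊆ F := fun _ h => h.1

theorem componentEdges_congr {u v : V} (h : conn G F u v) :
    componentEdges G F u = componentEdges G F v := by
  ext e
  exact and_congr_right fun _ => exists_congr fun z => and_congr_right fun _ =>
    ⟨fun h' => conn_trans (conn_symm h) h', fun h' => conn_trans h h'⟩

theorem disjoint_componentEdges {u v : V} (h : ¬ conn G F u v) :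
    Disjoint (componentEdges G F u) (componentEdges G F v) := by
  rw [Set.disjoint_left]
  rintro e ⟨he, z, ⟨z', hz⟩, huz⟩ ⟨-, y, hy, hvy⟩
  refine h (conn_trans ?_ (conn_symm hvy))
  rcases hy.eq_or_eq_of_isLink hz with rfl | rfl
  · exact huz
  · exact conn_trans huz (conn_link G he hz)

/-- An active vertex of `C` is connected to the boundary of `C` within `C`. -/
theorem exists_boundary_conn_of_mem_act (hF : IsSolution G D F) {C : Set E} {u : V}
    (hu : u ∈ act G D C) :
    ∃ b ∈ boundary G C, conn G (componentEdges G F u ∩ C) u b := by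
  obtain ⟨huC, hub | ⟨v, huv, hv⟩⟩ := hu
  · exact ⟨u, hub, conn_refl _ _⟩
  by_cases hub : u ∈ boundary G C
  · exact ⟨u, hub, conn_refl _ _⟩
  by_contra hcon
  have key : (conn G F u v) ∧ v ∈ verts G C ∧ conn G (componentEdges G F u ∩ C) u v := by
    refine conn_induction (P := fun z => conn G F u z ∧ z ∈ verts G C ∧
      conn G (componentEdges G F u ∩ C) u z) ?_ (hF.2 u v huv) ⟨conn_refl _ _, huC, conn_refl _ _⟩
    rintro e he p q hpq ⟨hFp, hpC, hp⟩
    have hpb : p ∉ boundary G C := fun h => hcon ⟨p, h, hp⟩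
    have heC : e ∈ C := by
      by_contra heC
      exact hpb ⟨hpC, e, heC, hpq.inc_left⟩
    exact ⟨conn_trans hFp (conn_link G he hpq), ⟨e, heC, hpq.inc_right⟩,
      conn_trans hp (conn_link G ⟨⟨he, p, hpq.inc_left, hFp⟩, heC⟩ hpq)⟩
  refine hv ⟨key.2.1, fun hvb => hcon ⟨v, hvb, key.2.2⟩⟩

/-- This lets active vertices of treated clusters be viewed from outside `C`. An edge of a disjoint
cluster, or an edge leaving a larger one, keeps the vertex itself off the interior of `C`; otherwise
its demand partner is not interior to `C'`, hence not to `C`. -/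
theorem exists_outer_conn_of_mem_act (hF : IsSolution G D F) {C C' : Set E}
    (hCC' : Disjoint C' C ∨ C ⊆ C') {u : V} (hu : u ∈ act G D C') :
    ∃ o, o ∉ verts G C \ boundary G C ∧ conn G F u o := by
  obtain ⟨⟨e, he, heu⟩, hu'⟩ := hu
  rcases hCC' with hdis | hsub
  · exact ⟨u, fun ⟨h, h'⟩ => h' ⟨h, e, Set.disjoint_left.1 hdis he, heu⟩, conn_refl _ _⟩
  · rcases hu' with ⟨-, f, hf, hfu⟩ | ⟨v, huv, hv⟩
    · exact ⟨u, fun ⟨h, h'⟩ => h' ⟨h, f, fun hfC => hf (hsub hfC), hfu⟩, conn_refl _ _⟩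
    · refine ⟨v, fun ⟨⟨f, hf, hfv⟩, h'⟩ => hv ⟨⟨f, hsub hf, hfv⟩, ?_⟩, hF.2 u v huv⟩
      rintro ⟨-, g, hg, hgv⟩
      exact h' ⟨⟨f, hf, hfv⟩, g, fun h => hg (hsub h), hgv⟩

end Active

theorem sum_ncard_le_ncard {ι E : Type*} (P : Finset ι) (s : ι → Set E) {X : Set E}
    (hX : X.Finite) (hsub : ∀ i ∈ P, s i ⊆ X)
    (hdisj : ∀ i ∈ P, ∀ j ∈ P, i ≠ j → Disjoint (s i) (s j)) :
    ∑ i ∈ P, (s i).ncard ≤ X.ncard := by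
  classical
  induction P using Finset.induction_on generalizing X with
  | empty => simp
  | insert a P ha ih =>
    rw [Finset.sum_insert ha]
    have haX := hsub a (Finset.mem_insert_self _ _)
    have h1 := ih (X := X \ s a) (hX.subset Set.sdiff_subset)
      (fun i hi => Set.subset_sdiff.2 ⟨hsub i (Finset.mem_insert_of_mem hi),
        hdisj i (Finset.mem_insert_of_mem hi) a (Finset.mem_insert_self _ _)
          (fun h => ha (h ▸ hi))⟩)
      (fun i hi j hj => hdisj i (Finset.mem_insert_of_mem hi) j (Finset.mem_insert_of_mem hj))
    have h2 := Set.ncard_sdiff_add_ncard_of_subset haX hX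
    omega

/-! ### The newly contracted edges and the radii -/

section Clusters

variable {V E : Type*} [LinearOrder E]

/-- `A^C`: the union of the sets contracted in the children of `C`. -/
noncomputable def childContract (G : Graph V E) (𝒞 : Set (Finset E)) (α : ℝ) (C : Finset E) :
    Set E :=
  ⋃ D : {D : Finset E // IsChild 𝒞 D C}, contract G 𝒞 α D.1

/-- `ρ^C`. -/
noncomputable def clusterRadius (G : Graph V E) (𝒞 : Set (Finset E)) (α : ℝ) (C : Finset E) : ℕ :=
  radius G α C (childContract G 𝒞 α C)

/-- The edges contracted in `C` but not in its children. -/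
noncomputable def newEdges (G : Graph V E) (𝒞 : Set (Finset E)) (α : ℝ) (C : Finset E) : Set E :=
  shortestPathForest (contracted G C (childContract G 𝒞 α C))
    (toC G (childContract G 𝒞 α C) '' boundary G C) (clusterRadius G 𝒞 α C)

variable {G : Graph V E} {𝒞 : Set (Finset E)} {α : ℝ} {C : Finset E}

theorem contract_eq : contract G 𝒞 α C = newEdges G 𝒞 α C ∪ childContract G 𝒞 α C := by
  rw [contract]; rfl

theorem newEdges_subset : newEdges G 𝒞 α C ⊆ C \ childContract G 𝒞 α C :=
  shortestPathForest_subset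

theorem contract_subset_biUnion (hC : C ∈ 𝒞) :
    contract G 𝒞 α C ⊆ ⋃ D ∈ {D ∈ 𝒞 | D ⊆ C}, newEdges G 𝒞 α D := by
  induction hn : C.card using Nat.strong_induction_on generalizing C with
  | _ n ih =>
  subst hn
  rw [contract_eq]
  refine Set.union_subset ?_ (Set.iUnion_subset ?_)
  · exact Set.subset_biUnion_of_mem (u := newEdges G 𝒞 α) (show C ∈ {D ∈ 𝒞 | D ⊆ C} from
      ⟨hC, subset_rfl⟩)
  · rintro ⟨D, hD⟩
    refine (ih _ (Finset.card_lt_card hD.2.1) hD.1 rfl).trans ?_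
    exact Set.biUnion_subset_biUnion_left fun D' hD' => ⟨hD'.1, hD'.2.trans hD.2.1.1⟩

theorem contract_subset_childContract {D : Finset E} (hD : D ∈ 𝒞) (hDC : D ⊂ C) :
    contract G 𝒞 α D ⊆ childContract G 𝒞 α C := by
  induction hn : C.card using Nat.strong_induction_on generalizing C with
  | _ n ih =>
  subst hn
  have hfin : {D' : Finset E | D' ∈ 𝒞 ∧ D ⊆ D' ∧ D' ⊂ C}.Finite :=
    (Finset.finite_toSet C.powerset).subset fun D' hD' => by
      simpa using hD'.2.2.1
  obtain ⟨M, ⟨hM, hDM, hMC⟩, hmax⟩ := hfin.exists_maximal ⟨D, hD, subset_rfl, hDC⟩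
  have hchild : IsChild 𝒞 M C := ⟨hM, hMC, fun D' hD' hMD' hD'C =>
    hMD'.2 (hmax ⟨hD', hDM.trans hMD'.1, hD'C⟩ hMD'.1)⟩
  have hle : contract G 𝒞 α M ⊆ childContract G 𝒞 α C :=
    Set.subset_iUnion (fun D : {D : Finset E // IsChild 𝒞 D C} => contract G 𝒞 α D.1) ⟨M, hchild⟩
  rcases eq_or_ne D M with rfl | hne
  · exact hle
  · refine (ih _ (Finset.card_lt_card hMC) (lt_of_le_of_ne hDM hne) rfl).trans
      (Set.Subset.trans ?_ hle)
    rw [contract_eq (C := M)]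
    exact Set.subset_union_right

theorem childContract_subset {U : Set E}
    (hU : ∀ D ∈ 𝒞, D ⊂ C → newEdges G 𝒞 α D ⊆ U) : childContract G 𝒞 α C ⊆ U := by
  refine Set.iUnion_subset fun ⟨D, hD⟩ => (contract_subset_biUnion hD.1).trans ?_
  exact Set.iUnion₂_subset fun D' hD' => hU D' hD'.1 (lt_of_le_of_lt hD'.2 hD.2.1)

/-- For nested clusters, the edges contracted in the smaller are already in the contracted set of
the larger one's children, where its shortest-path forest cannot use them. -/
theorem disjoint_newEdges {D : Finset E} (hD : D ∈ 𝒞) (hC : C ∈ 𝒞) (hne : D ≠ C)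
    (hnc : Noncrossing D C) : Disjoint (newEdges G 𝒞 α D) (newEdges G 𝒞 α C) := by
  have key : ∀ {D C : Finset E}, D ∈ 𝒞 → D ⊂ C →
      Disjoint (newEdges G 𝒞 α D) (newEdges G 𝒞 α C) := by
    intro D C hD hDC
    have h1 : newEdges G 𝒞 α D ⊆ childContract G 𝒞 α C := by
      refine Set.Subset.trans ?_ (contract_subset_childContract hD hDC)
      rw [contract_eq]
      exact Set.subset_union_left
    rw [Set.disjoint_left]
    exact fun e he he' => (newEdges_subset he').2 (h1 he)
  rcases hnc with h | h | h
  · exact key hD (lt_of_le_of_ne h hne)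
  · exact (key hC (lt_of_le_of_ne h hne.symm)).symm
  · rw [Set.disjoint_left]
    exact fun e he he' => Finset.disjoint_left.1 h (newEdges_subset he).1 (newEdges_subset he').1

theorem mul_clusterRadius_le (hα : 0 < α) :
    α * clusterRadius G 𝒞 α C ≤ (newEdges G 𝒞 α C).ncard := by
  refine Nat.sSup_mem (s := {ρ : ℕ | α * ρ ≤ (shortestPathForest
    (contracted G C (childContract G 𝒞 α C))
    (toC G (childContract G 𝒞 α C) '' boundary G C) ρ).ncard}) ⟨0, by simp⟩ ?_
  -- The forest lies in the finite set `C`, so `α * ρ ≤ C.card`; boundedness makes the supremum an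
  -- attained maximum.
  refine ⟨⌊(C.card : ℝ) / α⌋₊, fun ρ hρ => Nat.le_floor ?_⟩
  rw [le_div_iff₀ hα, mul_comm]
  refine le_trans hρ ?_
  rw [← Set.ncard_coe_finset C]
  exact_mod_cast Set.ncard_le_ncard (shortestPathForest_subset.trans Set.sdiff_subset)
    C.finite_toSet

/-- The radii of pairwise noncrossing clusters are bounded in total. -/
theorem sum_clusterRadius_le (hα : 0 < α) (hG : E(G).Finite)
    (h𝒞 : ∀ A ∈ 𝒞, (A : Set E) ⊆ E(G)) (hnc : ∀ A ∈ 𝒞, ∀ B ∈ 𝒞, Noncrossing A B)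
    (P : Finset (Finset E)) (hP : (P : Set (Finset E)) ⊆ 𝒞) :
    ∑ C ∈ P, (clusterRadius G 𝒞 α C : ℝ) ≤ α⁻¹ * E(G).ncard := by
  have hsub : ∀ C ∈ P, newEdges G 𝒞 α C ⊆ E(G) := fun C hC =>
    (newEdges_subset.trans Set.sdiff_subset).trans (h𝒞 C (hP hC))
  have hsum : (∑ C ∈ P, (newEdges G 𝒞 α C).ncard) ≤ E(G).ncard :=
    sum_ncard_le_ncard P _ hG hsub fun A hA B hB hAB =>
      disjoint_newEdges (hP hA) (hP hB) hAB (hnc A (hP hA) B (hP hB))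
  rw [← div_eq_inv_mul, le_div_iff₀ hα, mul_comm, Finset.mul_sum]
  refine (Finset.sum_le_sum fun C _ => mul_clusterRadius_le hα).trans ?_
  exact_mod_cast hsum

end Clusters

/-! ### Charging each component of `F` at most once -/

section Charging

variable {V E : Type*} {G : Graph V E} {F : Set E}

/-- `Z` is a set of charged vertices, in different components of `F`, such that each vertex of `K`
is equivalent in `r` to a vertex in an uncharged component of `F` that is at least as large. -/
structure IsCharging (G : Graph V E) (F : Set E) (K : Set V) (r : Setoid V) (Z : Finset V) :
    Prop where
  subset : ∀ z ∈ Z, z ∈ K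
  not_conn : ∀ z ∈ Z, ∀ z' ∈ Z, z ≠ z' → ¬ conn G F z z'
  exists_uncharged : ∀ x ∈ K, ∃ y ∈ K, (∀ z ∈ Z, ¬ conn G F y z) ∧ r x y ∧
    (componentEdges G F x).ncard ≤ (componentEdges G F y).ncard

/-- The total size of the components of the charged vertices. -/
noncomputable def charge (G : Graph V E) (F : Set E) (Z : Finset V) : ℕ :=
  ∑ z ∈ Z, (componentEdges G F z).ncard

theorem IsCharging.empty (G : Graph V E) (F : Set E) (r : Setoid V) :
    IsCharging G F ∅ r ∅ :=
  ⟨by simp, by simp, by simp⟩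

theorem IsCharging.mono {K : Set V} {r r' : Setoid V} {Z : Finset V}
    (h : IsCharging G F K r Z) (hr : ∀ x ∈ K, ∀ y ∈ K, r x y → r' x y) :
    IsCharging G F K r' Z := by
  refine ⟨h.subset, h.not_conn, fun x hx => ?_⟩
  obtain ⟨y, hy, hyZ, hxy, hle⟩ := h.exists_uncharged x hx
  exact ⟨y, hy, hyZ, hr x hx y hy hxy, hle⟩

/-- A new vertex in an uncharged component represents itself; one in a charged component borrows the
representative of the charged vertex there. -/
theorem IsCharging.extend {K K' : Set V} {r : Setoid V} {Z : Finset V}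
    (h : IsCharging G F K r Z) (hF : conn G F ≤ r) (hK : K ⊆ K') : IsCharging G F K' r Z := by
  refine ⟨fun z hz => hK (h.subset z hz), h.not_conn, fun x hx => ?_⟩
  by_cases hxZ : ∃ z ∈ Z, conn G F x z
  · obtain ⟨z, hz, hxz⟩ := hxZ
    obtain ⟨y, hy, hyZ, hzy, hle⟩ := h.exists_uncharged z (h.subset z hz)
    exact ⟨y, hK hy, hyZ, r.trans (hF hxz) hzy, (componentEdges_congr hxz) ▸ hle⟩
  · push Not at hxZ
    exact ⟨x, hx, hxZ, r.refl x, le_rfl⟩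

theorem IsCharging.charge_le {K : Set V} {r : Setoid V} {Z : Finset V}
    (h : IsCharging G F K r Z) (hF : F.Finite) : charge G F Z ≤ F.ncard :=
  sum_ncard_le_ncard Z _ hF (fun z _ => componentEdges_subset z) fun z hz z' hz' hne =>
    disjoint_componentEdges (h.not_conn z hz z' hz' hne)

/-- When two classes are merged, the smaller of their largest uncharged components is charged. -/
theorem IsCharging.merge {K : Set V} {r r' : Setoid V} {Z : Finset V}
    (h : IsCharging G F K r Z) (hF : conn G F ≤ r) (hr : r ≤ r') {x y : V} (hx : x ∈ K)
    (hy : y ∈ K) (hxy : ¬ r x y) (hxy' : r' x y) {c : ℕ}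
    (hcx : c ≤ (componentEdges G F x).ncard) (hcy : c ≤ (componentEdges G F y).ncard) :
    ∃ Z', IsCharging G F K r' Z' ∧ charge G F Z + c ≤ charge G F Z' := by
  classical
  obtain ⟨a, ha, haZ, hxa, hla⟩ := h.exists_uncharged x hx
  obtain ⟨b, hb, hbZ, hyb, hlb⟩ := h.exists_uncharged y hy
  have main : ∀ a b, a ∈ K → b ∈ K → (∀ z ∈ Z, ¬ conn G F a z) → (∀ z ∈ Z, ¬ conn G F b z) →
      ¬ r a b → r' a b → c ≤ (componentEdges G F a).ncard →
      (componentEdges G F a).ncard ≤ (componentEdges G F b).ncard →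
      ∃ Z', IsCharging G F K r' Z' ∧ charge G F Z + c ≤ charge G F Z' := by
    intro a b ha hb haZ hbZ hab hab' hc hle
    have haZ' : a ∉ Z := fun h => haZ a h (conn_refl _ _)
    -- `a` is charged; `b`, uncharged and at least as large, now represents whatever the component
    -- of `a` represented. Since `r` separates `a` and `b`, these are different components.
    refine ⟨insert a Z, ⟨?_, ?_, ?_⟩, ?_⟩
    · intro z hz
      rcases Finset.mem_insert.1 hz with rfl | hz
      · exact ha
      · exact h.subset z hz
    · intro z hz z' hz' hne
      rcases Finset.mem_insert.1 hz with rfl | hz <;> rcases Finset.mem_insert.1 hz' with rfl | hz'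
      · exact absurd rfl hne
      · exact haZ z' hz'
      · exact fun h => haZ z ‹z ∈ Z› (conn_symm h)
      · exact h.not_conn z hz z' hz' hne
    · intro u hu
      obtain ⟨v, hv, hvZ, huv, hluv⟩ := h.exists_uncharged u hu
      by_cases hva : conn G F v a
      · refine ⟨b, hb, fun z hz => ?_, r'.trans (hr (r.trans huv (hF hva))) hab', ?_⟩
        · rcases Finset.mem_insert.1 hz with rfl | hz
          · exact fun h => hab (r.symm (hF h))
          · exact hbZ z hz
        · rw [componentEdges_congr hva] at hluv
          exact hluv.trans hle
      · refine ⟨v, hv, fun z hz => ?_, hr huv, hluv⟩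
        rcases Finset.mem_insert.1 hz with rfl | hz
        · exact hva
        · exact hvZ z hz
    · rw [charge, charge, Finset.sum_insert haZ']
      omega
  have hab : ¬ r a b := fun h => hxy (r.trans hxa (r.trans h (r.symm hyb)))
  have hab' : r' a b := r'.trans (r'.symm (hr hxa)) (r'.trans hxy' (hr hyb))
  rcases le_total (componentEdges G F a).ncard (componentEdges G F b).ncard with hle | hle
  · exact main a b ha hb haZ hbZ hab hab' (hcx.trans hla) hle
  · exact main b a hb ha hbZ haZ (fun h => hab (r.symm h)) (r'.symm hab') (hcy.trans hlb) hle

end Charging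

theorem greedyPart_subset_act {V E : Type*} {G : Graph V E} {D : Set (Sym2 V)} {C A : Set E} {d : ℕ}
    {Q : Fin d → Set (Set (CVertex G A))} {j : Fin d} : greedyPart G D C A Q j ⊆ act G D C :=
  fun _ h => h.1.1

theorem DistLE.mono {W E : Type*} {H : Graph W E} {S : Set W} {v : W} {a b : ℝ}
    (h : DistLE H S v a) (hab : a ≤ b) : DistLE H S v b := by
  obtain ⟨n, hn, hw⟩ := h
  exact ⟨n, hn.trans hab, hw⟩

/-! ### From captured classes to simple configurations -/

section Capture

variable {V E : Type*} [LinearOrder E] {G : Graph V E} {D : Set (Sym2 V)} {𝒞 : Set (Finset E)}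
  {α β γ : ℝ} {C : Finset E} {L : ℤ → Set (Set (CVertex G (contract G 𝒞 α C)))}

/-- The classes of `r` on the active vertices of `C` are captured by regions at admissible scales,
up to the connectivity of the boundary. -/
def RegionsCapture (G : Graph V E) (D : Set (Sym2 V)) (𝒞 : Set (Finset E)) (α γ : ℝ)
    (C : Finset E) (L : ℤ → Set (Set (CVertex G (contract G 𝒞 α C)))) (r : Setoid V) : Prop :=
  ∃ d : ℕ, d ≤ (boundary G C).ncard ∧
  ∃ i : Fin d → ℤ,
    (∀ j, (2 : ℝ) ^ mu G D 𝒞 α C / (2 * γ) ≤ 2 ^ i j ∧ (2 : ℝ) ^ i j ≤ 2 ^ mu G D 𝒞 α C) ∧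
  ∃ Q : Fin d → Set (Set (CVertex G (contract G 𝒞 α C))),
    (∀ j, Q j ⊆ L (i j)) ∧
    (∀ j, ∀ x ∈ greedyPart G D C (contract G 𝒞 α C) Q j,
      ∀ y ∈ greedyPart G D C (contract G 𝒞 α C) Q j, r x y) ∧
    ∀ u ∈ act G D C, ∃ b ∈ boundary G C, u = b ∨
      ∃ j, u ∈ greedyPart G D C (contract G 𝒞 α C) Q j ∧
        b ∈ greedyPart G D C (contract G 𝒞 α C) Q j

/-- The regions are kept while the relation grows on active vertices: each part only has to lie
within a class, not be one. This is why later merging preserves simplicity. -/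
theorem RegionsCapture.mono {r r' : Setoid V} (h : RegionsCapture G D 𝒞 α γ C L r)
    (hr : ∀ x ∈ act G D C, ∀ y ∈ act G D C, r x y → r' x y) :
    RegionsCapture G D 𝒞 α γ C L r' := by
  obtain ⟨d, hd, i, hi, Q, hQ, hpart, hcov⟩ := h
  exact ⟨d, hd, i, hi, Q, hQ, fun j x hx y hy => hr x (greedyPart_subset_act hx) y
    (greedyPart_subset_act hy) (hpart j x hx y hy), hcov⟩

/-- The parts link every active vertex to a boundary vertex, and connectivity among boundary
vertices is the join of the inner and outer partitions. Only the relation `conn G F` enters the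
hypothesis. -/
theorem RegionsCapture.isSimple {F : Set E} (h : RegionsCapture G D 𝒞 α γ C L (conn G F)) :
    IsSimple G D 𝒞 α γ C L (canonicalConfiguration G D F C) := by
  obtain ⟨d, hd, i, hi, Q, hQ, hpart, hcov⟩ := h
  refine ⟨d, hd, i, hi, Q, hQ, ?_⟩
  set P := partsSetoid (greedyPart G D C (contract G 𝒞 α C) Q) with hP
  change restrictTo (conn G F) (act G D C) = restrictTo (conn G (F ∩ C)) (boundary G C) ⊔
    restrictTo (conn G (F \ C)) (boundary G C) ⊔ P
  set I := restrictTo (conn G (F ∩ C)) (boundary G C) ⊔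
    restrictTo (conn G (F \ C)) (boundary G C) with hI
  have hPle : P ≤ restrictTo (conn G F) (act G D C) := by
    refine Setoid.eqvGen_le ?_
    rintro x y ⟨j, hx, hy⟩
    exact Or.inr ⟨greedyPart_subset_act hx, greedyPart_subset_act hy, hpart j x hx y hy⟩
  have hact : ∀ u ∈ act G D C, ∃ b ∈ boundary G C, P u b := by
    intro u hu
    obtain ⟨b, hb, rfl | ⟨j, hj⟩⟩ := hcov u hu
    · exact ⟨u, hb, Setoid.refl' _ _⟩
    · exact ⟨b, hb, Relation.EqvGen.rel _ _ ⟨j, hj⟩⟩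
  have hconn : ∀ {x y}, P x y → conn G F x y := by
    intro x y hxy
    rcases hPle hxy with rfl | ⟨-, -, h⟩
    · exact conn_refl _ _
    · exact h
  apply le_antisymm
  · rintro x y (rfl | ⟨hx, hy, h⟩)
    · exact Setoid.refl' _ _
    · obtain ⟨a, ha, hxa⟩ := hact x hx
      obtain ⟨b, hb, hyb⟩ := hact y hy
      have hab : I a b := canonical_aux G F C ha hb
        (conn_trans (conn_symm (hconn hxa)) (conn_trans h (hconn hyb)))
      exact Setoid.trans' _ ((le_sup_right : P ≤ I ⊔ P) hxa)
        (Setoid.trans' _ ((le_sup_left : I ≤ I ⊔ P) hab)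
          (Setoid.symm' _ ((le_sup_right : P ≤ I ⊔ P) hyb)))
  · refine sup_le (le_trans (le_of_eq ?_) (?_ : restrictTo (canonicalConfiguration G D F C).pall
      (boundary G C) ≤ restrictTo (conn G F) (act G D C))) hPle
    · exact (canonicalConfiguration G D F C).pall_boundary.symm
    · rintro x y (rfl | ⟨-, -, h⟩)
      · exact Setoid.refl' _ _
      · exact h

/-- An enumeration of the classes that meet a finite set, in the order of a given key. -/
theorem exists_monotone_representatives {S : Set V} (hS : S.Finite) (r : Setoid V) (f : V → ℤ) :
    ∃ d ≤ S.ncard, ∃ t : Fin d → V, (∀ j, t j ∈ S) ∧ (∀ b ∈ S, ∃ j, r b (t j)) ∧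
      (∀ i j, r (t i) (t j) → i = j) ∧ Monotone (f ∘ t) := by
  have hT : (Quotient.mk r '' S).Finite := hS.image _
  have := hT.fintype
  let g : Fin (Fintype.card (Quotient.mk r '' S)) ≃ (Quotient.mk r '' S) :=
    (Fintype.equivFin _).symm
  choose s hs hsg using fun j => (g j).2
  let σ := Tuple.sort (f ∘ s)
  refine ⟨_, ?_, s ∘ σ, fun j => hs _, fun b hb => ?_, fun i j hij => ?_,
    Tuple.monotone_sort (f ∘ s)⟩
  · rw [← Nat.card_eq_fintype_card, Nat.card_coe_set_eq]
    exact Set.ncard_image_le hS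
  · refine ⟨σ.symm (g.symm ⟨Quotient.mk r b, b, hb, rfl⟩), ?_⟩
    refine Quotient.exact ?_
    simp [hsg]
  · have : g (σ i) = g (σ j) := by
      apply Subtype.ext
      rw [← hsg, ← hsg]
      exact Quotient.sound hij
    exact σ.injective (g.injective this)

/-- Regions capture the classes of `r` if no region that meets a class contains an active vertex of
a class at the same or a larger scale. -/
theorem regionsCapture_of_stable {r : Setoid V} (hC : (boundary G C).Finite)
    (hact : ∀ u ∈ act G D C, ∃ b ∈ boundary G C, r u b)
    (hL : ∀ i : ℤ, i ≤ mu G D 𝒞 α C →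
      IsCovering (quotientGraph G 𝒞 α C) (quotientBoundary G 𝒞 α C) β i (L i))
    (f : V → ℤ) (hf : ∀ x ∈ act G D C, ∀ y ∈ act G D C, r x y → f x = f y)
    (hfμ : ∀ x ∈ act G D C, (2 : ℝ) ^ mu G D 𝒞 α C / (2 * γ) ≤ 2 ^ f x ∧ f x ≤ mu G D 𝒞 α C)
    (hfd : ∀ x ∈ act G D C, DistLE (quotientGraph G 𝒞 α C) (quotientBoundary G 𝒞 α C)
      (toC G (contract G 𝒞 α C) x) (2 ^ f x))
    (hstable : ∀ x ∈ act G D C, ∀ y ∈ act G D C, ¬ r x y → f x ≤ f y → ∀ q ∈ L (f x),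
      toC G (contract G 𝒞 α C) x ∈ q → toC G (contract G 𝒞 α C) y ∉ q) :
    RegionsCapture G D 𝒞 α γ C L r := by
  obtain ⟨d, hd, t, htS, htsurj, htinj, htmono⟩ := exists_monotone_representatives hC r f
  have hta : ∀ j, t j ∈ act G D C := fun j => boundary_subset_act G D C (htS j)
  -- All regions at the scale of the `j`-th class that meet it: they cover the class, and by
  -- stability they miss all later classes, so subtracting earlier parts leaves exactly this class.
  let Q : Fin d → Set (Set (CVertex G (contract G 𝒞 α C))) := fun j =>
    {q ∈ L (f (t j)) | ∃ x ∈ act G D C, r x (t j) ∧ toC G (contract G 𝒞 α C) x ∈ q}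
  have hmem : ∀ u ∈ act G D C, ∀ j, r u (t j) →
      u ∈ uncontract G (contract G 𝒞 α C) (⋃₀ Q j) := by
    intro u hu j huj
    have hfu := hf u hu _ (hta j) huj
    obtain ⟨q, hq, huq⟩ := (hL (f u) (hfμ u hu).2).cover _ (hfd u hu)
    exact ⟨q, ⟨hfu ▸ hq, u, hu, huj, huq⟩, huq⟩
  have hnot : ∀ u ∈ act G D C, ∀ j l, j < l → r u (t l) →
      u ∉ uncontract G (contract G 𝒞 α C) (⋃₀ Q j) := by
    rintro u hu j l hjl hul ⟨q, ⟨hq, x, hx, hxj, hxq⟩, huq⟩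
    have hfx := hf x hx _ (hta j) hxj
    have hfu := hf u hu _ (hta l) hul
    refine hstable x hx u hu (fun hxu => hjl.ne (htinj j l ?_)) ?_ q (hfx ▸ hq) hxq huq
    · exact r.trans (r.symm hxj) (r.trans hxu hul)
    · rw [hfx, hfu]
      exact htmono hjl.le
  have hpart : ∀ u ∈ act G D C, ∀ j, u ∈ greedyPart G D C (contract G 𝒞 α C) Q j ↔ r u (t j) := by
    intro u hu j
    constructor
    · rintro ⟨⟨-, huj⟩, hearlier⟩
      obtain ⟨b, hb, hub⟩ := hact u hu
      obtain ⟨l, hl⟩ := htsurj b hb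
      have hul := r.trans hub hl
      rcases lt_trichotomy l j with h | rfl | h
      · exact absurd (Set.mem_iUnion.2 ⟨⟨l, h⟩, hmem u hu l hul⟩) hearlier
      · exact hul
      · exact absurd huj (hnot u hu j l h hul)
    · intro huj
      refine ⟨⟨hu, hmem u hu j huj⟩, fun h => ?_⟩
      obtain ⟨⟨l, hl⟩, hul⟩ := Set.mem_iUnion.1 h
      exact hnot u hu l j hl huj hul
  refine ⟨d, hd, f ∘ t, fun j => ⟨(hfμ _ (hta j)).1, ?_⟩, Q, fun j q hq => hq.1,
    fun j x hx y hy => ?_, fun u hu => ?_⟩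
  · have := zpow_le_zpow_right₀ (one_le_two (α := ℝ)) (hfμ _ (hta j)).2
    rwa [zpow_natCast] at this
  · exact r.trans ((hpart x (greedyPart_subset_act hx) j).1 hx)
      (r.symm ((hpart y (greedyPart_subset_act hy) j).1 hy))
  · obtain ⟨b, hb, hub⟩ := hact u hu
    obtain ⟨j, hj⟩ := htsurj b hb
    exact ⟨b, hb, Or.inr ⟨j, (hpart u hu j).2 (r.trans hub hj),
      (hpart b (boundary_subset_act G D C hb) j).2 hj⟩⟩

end Capture

/-! ### Distances of active vertices and their scales -/

section Scales

variable {V E : Type*} [LinearOrder E] {G : Graph V E} {D : Set (Sym2 V)} {𝒞 : Set (Finset E)}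
  {α β γ : ℝ} {C : Finset E} {F : Set E}

theorem exists_hasWalk_of_mem_act (hF : IsSolution G D F) {u : V} (hu : u ∈ act G D C) :
    ∃ n ≤ (componentEdges G F u ∩ C).ncard,
      HasWalk (quotientGraph G 𝒞 α C) (quotientBoundary G 𝒞 α C) n
        (toC G (contract G 𝒞 α C) u) := by
  obtain ⟨b, hb, hconn⟩ := exists_boundary_conn_of_mem_act hF hu
  exact exists_hasWalk_of_conn (C.finite_toSet.subset Set.inter_subset_right)
    Set.inter_subset_right hconn ⟨b, hb, rfl⟩

theorem distLE_of_mem_act (hF : IsSolution G D F) (hFfin : F.Finite) {u : V}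
    (hu : u ∈ act G D C) :
    DistLE (quotientGraph G 𝒞 α C) (quotientBoundary G 𝒞 α C) (toC G (contract G 𝒞 α C) u)
      (componentEdges G F u).ncard := by
  obtain ⟨n, hn, hw⟩ := exists_hasWalk_of_mem_act (𝒞 := 𝒞) (α := α) hF hu
  exact ⟨n, by exact_mod_cast hn.trans (Set.ncard_le_ncard Set.inter_subset_left
    (hFfin.subset (componentEdges_subset u))), hw⟩

theorem dist_le_of_mem_act (hF : IsSolution G D F) {u : V} (hu : u ∈ act G D C) :
    dist (quotientGraph G 𝒞 α C) (quotientBoundary G 𝒞 α C) (toC G (contract G 𝒞 α C) u)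
      ≤ (F ∩ C).ncard := by
  obtain ⟨n, hn, hw⟩ := exists_hasWalk_of_mem_act (𝒞 := 𝒞) (α := α) hF hu
  refine dist_le_iff.2 ⟨n, hn.trans ?_, hw⟩
  exact Set.ncard_le_ncard (Set.inter_subset_inter_left _ (componentEdges_subset u))
    (C.finite_toSet.subset Set.inter_subset_right)

theorem dist_lt_two_pow_mu (hF : IsSolution G D F) {u : V} (hu : u ∈ act G D C) :
    dist (quotientGraph G 𝒞 α C) (quotientBoundary G 𝒞 α C) (toC G (contract G 𝒞 α C) u)
      < ((2 ^ mu G D 𝒞 α C : ℕ) : ℕ∞) := by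
  -- Since all these distances are at most `(F ∩ C).ncard`, that number is an admissible exponent;
  -- the infimum is thus attained rather than a default value.
  refine Nat.sInf_mem (s := {n : ℕ | ∀ u ∈ act G D C,
    dist (quotientGraph G 𝒞 α C) (quotientBoundary G 𝒞 α C) (toC G (contract G 𝒞 α C) u) <
      ((2 ^ n : ℕ) : ℕ∞)}) ⟨(F ∩ C).ncard, fun u hu => ?_⟩ u hu
  exact (dist_le_of_mem_act hF hu).trans_lt (by exact_mod_cast Nat.lt_two_pow_self)

theorem distLE_two_pow_mu (hF : IsSolution G D F) {u : V} (hu : u ∈ act G D C) :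
    DistLE (quotientGraph G 𝒞 α C) (quotientBoundary G 𝒞 α C) (toC G (contract G 𝒞 α C) u)
      (2 ^ (mu G D 𝒞 α C : ℤ)) := by
  obtain ⟨n, hn, hw⟩ := dist_le_iff.1 (dist_lt_two_pow_mu (𝒞 := 𝒞) (α := α) hF hu).le
  exact ⟨n, by rw [zpow_natCast]; exact_mod_cast hn, hw⟩

/-- If `μ` is positive, its minimality gives an active vertex at distance at least `2 ^ (μ - 1)`,
reached inside `F ∩ C`. For `μ = 0` a nonboundary active vertex forces an edge of `F ∩ C`; without
such a vertex the bound could fail as `1 ≤ 0`. -/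
theorem two_pow_mu_le (hF : IsSolution G D F) (hne : ¬ act G D C ⊆ boundary G C) :
    2 ^ mu G D 𝒞 α C ≤ 2 * (F ∩ C).ncard := by
  have hfin : (F ∩ C).Finite := C.finite_toSet.subset Set.inter_subset_right
  obtain ⟨u, hu, hub⟩ := Set.not_subset.1 hne
  rcases Nat.eq_zero_or_pos (mu G D 𝒞 α C) with h0 | hpos
  · obtain ⟨b, hb, hconn⟩ := exists_boundary_conn_of_mem_act hF hu
    rcases conn_eq_or G hconn with rfl | ⟨⟨e, he, -⟩, -⟩
    · exact absurd hb hub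
    · have : 0 < (F ∩ C).ncard := (Set.ncard_pos hfin).2 ⟨e, he.1.1, he.2⟩
      rw [h0]
      omega
  · have hlt : mu G D 𝒞 α C - 1 < mu G D 𝒞 α C := by omega
    have := Nat.notMem_of_lt_sInf hlt
    simp only [Set.mem_ofPred_eq, not_forall, not_lt] at this
    obtain ⟨v, hv, hle⟩ := this
    have h2 : 2 ^ (mu G D 𝒞 α C - 1) ≤ (F ∩ C).ncard := by
      exact_mod_cast hle.trans (dist_le_of_mem_act hF hv)
    obtain ⟨k, hk⟩ := Nat.exists_eq_succ_of_ne_zero hpos.ne'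
    rw [hk] at h2 ⊢
    rw [pow_succ]
    simp at h2
    omega

/-- The least scale of an active vertex, among the scales that are at least `i₀`. -/
theorem exists_scale (hF : IsSolution G D F) {i₀ : ℤ} (hi₀ : i₀ ≤ mu G D 𝒞 α C) {u : V}
    (hu : u ∈ act G D C) :
    ∃ i : ℤ, i₀ ≤ i ∧ i ≤ mu G D 𝒞 α C ∧
      DistLE (quotientGraph G 𝒞 α C) (quotientBoundary G 𝒞 α C) (toC G (contract G 𝒞 α C) u)
        (2 ^ i) ∧
      (i₀ < i → ¬ DistLE (quotientGraph G 𝒞 α C) (quotientBoundary G 𝒞 α C)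
        (toC G (contract G 𝒞 α C) u) (2 ^ (i - 1))) := by
  obtain ⟨i, ⟨hi, hd⟩, hmin⟩ := Int.exists_least_of_bdd
    (P := fun i => i₀ ≤ i ∧ DistLE (quotientGraph G 𝒞 α C) (quotientBoundary G 𝒞 α C)
      (toC G (contract G 𝒞 α C) u) (2 ^ i)) ⟨i₀, fun z hz => hz.1⟩
    ⟨mu G D 𝒞 α C, hi₀, distLE_two_pow_mu hF hu⟩
  refine ⟨i, hi, hmin _ ⟨hi₀, distLE_two_pow_mu hF hu⟩, hd, fun hlt hd' => ?_⟩
  have := hmin (i - 1) ⟨by omega, hd'⟩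
  omega

/-- The component of `u` in `F` contains a path to `∂C`, so a vertex far from `∂C` has a large
component to charge. -/
theorem two_zpow_le_of_not_distLE (hF : IsSolution G D F) (hFfin : F.Finite) {u : V}
    (hu : u ∈ act G D C) {i : ℤ}
    (h : ¬ DistLE (quotientGraph G 𝒞 α C) (quotientBoundary G 𝒞 α C)
      (toC G (contract G 𝒞 α C) u) (2 ^ (i - 1))) :
    (2 : ℝ) ^ i ≤ 2 * (componentEdges G F u).ncard := by
  by_contra! hlt
  refine h ((distLE_of_mem_act hF hFfin hu).mono ?_)
  rw [zpow_sub_one₀ two_ne_zero]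
  linarith

end Scales

/-! ### Merging classes through regions at one cluster -/

section Merging

variable {V E : Type*} [LinearOrder E] {G : Graph V E} {D : Set (Sym2 V)} {𝒞 : Set (Finset E)}
  {α β γ : ℝ} {C : Finset E} {L : ℤ → Set (Set (CVertex G (contract G 𝒞 α C)))} {F : Set E}

/-- Vertices in a common region can be connected at a cost of at most the diameter. -/
theorem exists_edges_of_mem_region {i : ℤ}
    (hL : IsCovering (quotientGraph G 𝒞 α C) (quotientBoundary G 𝒞 α C) β i (L i))
    {q : Set (CVertex G (contract G 𝒞 α C))} (hq : q ∈ L i) {x y : V}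
    (hx : toC G (contract G 𝒞 α C) x ∈ q) (hy : toC G (contract G 𝒞 α C) y ∈ q) :
    ∃ Y ⊆ (C : Set E), (Y.ncard : ℝ) ≤ β * 2 ^ i ∧ conn G (Y ∪ contract G 𝒞 α C) x y := by
  obtain ⟨n, hn, hw⟩ := hL.diam q hq _ hx _ hy
  obtain ⟨s, hs, Y, hY, -, hcard, hconn⟩ := exists_edges_of_hasWalk hw
  exact ⟨Y, hY.trans Set.sdiff_subset, le_trans (by exact_mod_cast hcard) hn,
    hconn x y hs.symm rfl⟩

/-- The least admissible scale. -/
theorem exists_least_scale (hγ : 1 / 2 ≤ γ) (μ : ℕ) :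
    ∃ i : ℤ, i ≤ μ ∧ (2 : ℝ) ^ μ / (2 * γ) ≤ 2 ^ i ∧ (2 : ℝ) ^ i ≤ 2 ^ μ / γ := by
  have hpos : (0 : ℝ) < 2 ^ μ / (2 * γ) := by positivity
  -- The next power of two exceeds the lower limit by a factor less than 2, and `1 / 2 ≤ γ` keeps it
  -- at most `2 ^ μ`.
  obtain ⟨n, hn, hn'⟩ := exists_mem_Ioc_zpow hpos (one_lt_two (α := ℝ))
  refine ⟨n + 1, ?_, hn', ?_⟩
  · have h1 : (2 : ℝ) ^ n < 2 ^ (μ : ℤ) := by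
      refine hn.trans_le ?_
      rw [zpow_natCast]
      exact div_le_self (by positivity) (by linarith)
    have := (zpow_lt_zpow_iff_right₀ (one_lt_two (α := ℝ))).1 h1
    omega
  · rw [zpow_add_one₀ two_ne_zero]
    have : (2 : ℝ) ^ μ / γ = 2 ^ μ / (2 * γ) * 2 := by
      field_simp
    rw [this]
    linarith

/-- Merging classes along paths in regions until the regions capture the classes. -/
theorem exists_regionsCapture (hG : E(G).Finite) (hF : IsSolution G D F)
    (hCG : (C : Set E) ⊆ E(G)) (hβ : 0 < β) (hγ : 1 / 2 ≤ γ)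
    (hL : ∀ i : ℤ, i ≤ mu G D 𝒞 α C →
      IsCovering (quotientGraph G 𝒞 α C) (quotientBoundary G 𝒞 α C) β i (L i))
    {U : Set E} (hU : contract G 𝒞 α C ⊆ U) {K : Set V} (hK : act G D C ⊆ K)
    {W : Set E} (hFW : F ⊆ W) (hWG : W ⊆ E(G)) {Z : Finset V}
    (hZ : IsCharging G F K (conn G (W ∪ U)) Z) :
    ∃ W' Z', W ⊆ W' ∧ W' ⊆ E(G) ∧ IsCharging G F K (conn G (W' ∪ U)) Z' ∧
      RegionsCapture G D 𝒞 α γ C L (conn G (W' ∪ U)) ∧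
      (W'.ncard : ℝ) + 2 * β * charge G F Z ≤ W.ncard + 2 * β * charge G F Z' +
        2 * β / γ * (F ∩ C).ncard * ((boundary G C).ncard - 1 : ℕ) := by
  have hFfin : F.Finite := hG.subset hF.1
  have hbfin : (boundary G C).Finite := boundary_finite G C.finite_toSet
  by_cases hsub : act G D C ⊆ boundary G C
  · refine ⟨W, Z, subset_rfl, hWG, hZ, ⟨0, Nat.zero_le _, Fin.elim0, fun j => j.elim0, Fin.elim0,
      fun j => j.elim0, fun j => j.elim0, fun u hu => ⟨u, hsub hu, Or.inl rfl⟩⟩, ?_⟩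
    have : 0 ≤ 2 * β / γ * (F ∩ C).ncard * ((boundary G C).ncard - 1 : ℕ) := by positivity
    linarith
  have hbne : (boundary G C).Nonempty := by
    obtain ⟨u, hu, -⟩ := Set.not_subset.1 hsub
    obtain ⟨b, hb, -⟩ := exists_boundary_conn_of_mem_act hF hu
    exact ⟨b, hb⟩
  have hafin : (act G D C).Finite :=
    (verts_finite G C.finite_toSet).subset fun _ h => h.1
  obtain ⟨i₀, hi₀μ, hi₀, hi₀'⟩ := exists_least_scale hγ (mu G D 𝒞 α C)
  have hclamp : β * 2 ^ i₀ ≤ 2 * β / γ * (F ∩ C).ncard := by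
    have h1 : (2 : ℝ) ^ mu G D 𝒞 α C ≤ 2 * (F ∩ C).ncard := by
      exact_mod_cast two_pow_mu_le (𝒞 := 𝒞) (α := α) hF hsub
    calc β * 2 ^ i₀ ≤ β * (2 ^ mu G D 𝒞 α C / γ) := by gcongr
      _ ≤ β * (2 * (F ∩ C).ncard / γ) := by gcongr
      _ = _ := by ring
  set κ := 2 * β / γ * (F ∩ C).ncard with hκ
  have hκ0 : 0 ≤ κ := by positivity
  choose! lev hlev₀ hlevμ hlevd hlevn using
    fun u hu => exists_scale (𝒞 := 𝒞) (α := α) (u := u) hF hi₀μ hu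
  -- The summand `κ` on the left accounts for the last class, which is never merged away: from `N`
  -- classes at most `N - 1` merges occur.
  suffices main : ∀ N, ∀ W Z, F ⊆ W → W ⊆ E(G) → IsCharging G F K (conn G (W ∪ U)) Z →
      classCount (conn G (W ∪ U)) (boundary G C) = N →
      ∃ W' Z', W ⊆ W' ∧ W' ⊆ E(G) ∧ IsCharging G F K (conn G (W' ∪ U)) Z' ∧
        RegionsCapture G D 𝒞 α γ C L (conn G (W' ∪ U)) ∧
        (W'.ncard : ℝ) + 2 * β * charge G F Z + κ ≤ W.ncard + 2 * β * charge G F Z' + κ * N by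
    obtain ⟨W', Z', h1, h2, h3, h4, h5⟩ := main _ W Z hFW hWG hZ rfl
    refine ⟨W', Z', h1, h2, h3, h4, ?_⟩
    have hle : (classCount (conn G (W ∪ U)) (boundary G C) : ℝ) ≤ (boundary G C).ncard := by
      exact_mod_cast classCount_le hbfin
    have hpos : 1 ≤ (boundary G C).ncard := (Set.ncard_pos hbfin).2 hbne
    have := mul_le_mul_of_nonneg_left hle hκ0
    push_cast [Nat.cast_sub hpos]
    linarith
  intro N
  induction N using Nat.strong_induction_on with
  | _ N ih =>
  intro W Z hFW hWG hZ hN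
  set r := conn G (W ∪ U) with hr
  have hFr : conn G F ≤ r := fun _ _ h => conn_mono G (hFW.trans Set.subset_union_left) h
  have hact : ∀ u ∈ act G D C, ∃ b ∈ boundary G C, r u b := by
    intro u hu
    obtain ⟨b, hb, hub⟩ := exists_boundary_conn_of_mem_act hF hu
    exact ⟨b, hb, hFr (conn_mono G (Set.inter_subset_left.trans (componentEdges_subset u)) hub)⟩
  have htop : ∀ x ∈ act G D C, ∃ t ∈ act G D C, r x t ∧
      ∀ u ∈ act G D C, r x u → lev u ≤ lev t := by
    intro x hx
    obtain ⟨t, ⟨ht, hxt⟩, hmax⟩ := Set.exists_max_image {t ∈ act G D C | r x t} lev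
      (hafin.subset fun _ h => h.1) ⟨x, hx, r.refl x⟩
    exact ⟨t, ht, hxt, fun u hu hxu => hmax u ⟨hu, hxu⟩⟩
  choose! top htopa htopr htopmax using htop
  by_cases hstable : ∀ x ∈ act G D C, ∀ y ∈ act G D C, ¬ r x y → lev (top x) ≤ lev (top y) →
      ∀ q ∈ L (lev (top x)), toC G (contract G 𝒞 α C) x ∈ q → toC G (contract G 𝒞 α C) y ∉ q
  · refine ⟨W, Z, subset_rfl, hWG, hZ, ?_, ?_⟩
    · refine regionsCapture_of_stable hbfin hact hL (lev ∘ top) ?_ ?_ ?_ hstable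
      · intro x hx y hy hxy
        refine le_antisymm (htopmax y hy _ (htopa x hx) ?_) (htopmax x hx _ (htopa y hy) ?_)
        · exact r.trans (r.symm hxy) (htopr x hx)
        · exact r.trans hxy (htopr y hy)
      · intro x hx
        refine ⟨hi₀.trans ?_, hlevμ _ (htopa x hx)⟩
        exact zpow_le_zpow_right₀ one_le_two (hlev₀ _ (htopa x hx))
      · intro x hx
        refine (hlevd x hx).mono (zpow_le_zpow_right₀ one_le_two ?_)
        exact htopmax x hx x hx (r.refl x)
    · have hpos : 1 ≤ N := hN ▸ classCount_pos hbfin hbne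
      have : κ * 1 ≤ κ * N := mul_le_mul_of_nonneg_left (by exact_mod_cast hpos) hκ0
      linarith
  push Not at hstable
  obtain ⟨x, hx, y, hy, hxy, hle, q, hq, hxq, hyq⟩ := hstable
  obtain ⟨Y, hYC, hYcard, hYconn⟩ :=
    exists_edges_of_mem_region (hL _ (hlevμ _ (htopa x hx))) hq hxq hyq
  set i := lev (top x) with hi
  have hWW' : W ⊆ W ∪ Y := Set.subset_union_left
  have hrr' : r ≤ conn G (W ∪ Y ∪ U) := fun _ _ h =>
    conn_mono G (Set.union_subset_union_left _ hWW') h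
  have hxy' : conn G (W ∪ Y ∪ U) x y :=
    conn_mono G (Set.union_subset_union Set.subset_union_right hU) hYconn
  have hlt : classCount (conn G (W ∪ Y ∪ U)) (boundary G C) < N := by
    obtain ⟨a, ha, hxa⟩ := hact x hx
    obtain ⟨b, hb, hyb⟩ := hact y hy
    rw [← hN]
    refine classCount_lt hbfin hrr' ha hb (fun h => hxy ?_) ?_
    · exact r.trans hxa (r.trans h (r.symm hyb))
    · exact conn_trans (conn_symm (hrr' hxa)) (conn_trans hxy' (hrr' hyb))
  have hcard : ((W ∪ Y).ncard : ℝ) ≤ W.ncard + β * 2 ^ i := by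
    have : ((W ∪ Y).ncard : ℝ) ≤ W.ncard + Y.ncard := by exact_mod_cast Set.ncard_union_le W Y
    linarith
  -- At the least scale the join is paid by `κ`. Above it, the farthest vertices of both classes
  -- have `F`-components of at least `2 ^ i / 2` edges, so charging the smaller uncharged
  -- representative pays `β * 2 ^ i`.
  have hcharge : ∃ Z', IsCharging G F K (conn G (W ∪ Y ∪ U)) Z' ∧
      β * 2 ^ i + 2 * β * charge G F Z ≤ κ + 2 * β * charge G F Z' := by
    rcases eq_or_lt_of_le (hlev₀ _ (htopa x hx)) with h | h
    · refine ⟨Z, hZ.mono fun a _ b _ hab => hrr' hab, ?_⟩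
      rw [hi, ← h]
      linarith
    · have htx := hlevn _ (htopa x hx) h
      have hty := hlevn _ (htopa y hy) (h.trans_le hle)
      have h1 : (2 : ℝ) ^ i ≤ 2 * (componentEdges G F (top x)).ncard :=
        two_zpow_le_of_not_distLE hF hFfin (htopa x hx) htx
      have h2 : (2 : ℝ) ^ i ≤ 2 * (componentEdges G F (top y)).ncard :=
        (zpow_le_zpow_right₀ one_le_two hle).trans
          (two_zpow_le_of_not_distLE hF hFfin (htopa y hy) hty)
      obtain ⟨Z', hZ', hc⟩ := hZ.merge hFr hrr' (hK (htopa x hx)) (hK (htopa y hy))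
        (fun h => hxy (r.trans (htopr x hx) (r.trans h (r.symm (htopr y hy)))))
        (conn_trans (conn_symm (hrr' (htopr x hx))) (conn_trans hxy' (hrr' (htopr y hy))))
        (min_le_left _ _) (min_le_right _ _)
      refine ⟨Z', hZ', ?_⟩
      have h3 : (2 : ℝ) ^ i ≤
          2 * (min (componentEdges G F (top x)).ncard (componentEdges G F (top y)).ncard : ℕ) := by
        rcases min_choice (componentEdges G F (top x)).ncard
          (componentEdges G F (top y)).ncard with h | h <;> rw [h] <;> assumption
      have h4 : (charge G F Z : ℝ) +
          (min (componentEdges G F (top x)).ncard (componentEdges G F (top y)).ncard : ℕ)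
            ≤ charge G F Z' := by exact_mod_cast hc
      have h5 : (2 : ℝ) ^ i + 2 * charge G F Z ≤ 2 * charge G F Z' := by linarith
      have := mul_le_mul_of_nonneg_left h5 hβ.le
      linarith
  obtain ⟨Z₁, hZ₁, hcost⟩ := hcharge
  obtain ⟨W', Z', h1, h2, h3, h4, h5⟩ := ih _ hlt (W ∪ Y) Z₁ (hFW.trans hWW')
    (Set.union_subset hWG (hYC.trans hCG)) hZ₁ rfl
  refine ⟨W', Z', hWW'.trans h1, h2, h3, h4, ?_⟩
  have h6 : κ * (classCount (conn G (W ∪ Y ∪ U)) (boundary G C) + 1) ≤ κ * N :=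
    mul_le_mul_of_nonneg_left (by exact_mod_cast hlt) hκ0
  linarith

end Merging

/-! ### Treating one more cluster -/

section TopDown

variable {V E : Type*} [LinearOrder E] {G : Graph V E} {D : Set (Sym2 V)} {𝒞 : Set (Finset E)}
  {α β γ : ℝ} {F : Set E}
  {L : (C : Finset E) → ℤ → Set (Set (CVertex G (contract G 𝒞 α C)))}

/-- The connectivity of the boundary of a cluster that uses contracted edges of the cluster can be
realized by few of these edges. -/
theorem exists_subset_newEdges {C : Finset E} {U : Set E} (hU : childContract G 𝒞 α C ⊆ U) :
    ∃ X ⊆ newEdges G 𝒞 α C,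
      X.ncard ≤ 2 * clusterRadius G 𝒞 α C * ((boundary G C).ncard - 1) ∧
      ∀ b ∈ boundary G C, ∀ b' ∈ boundary G C,
        conn G (U ∪ newEdges G 𝒞 α C) b b' → conn G (U ∪ X) b b' := by
  have hnear : ∀ e ∈ newEdges G 𝒞 α C, ∃ s ∈ boundary G C, ∀ z, G.Inc e z →
      ∃ X ⊆ newEdges G 𝒞 α C, X.Finite ∧ X.ncard ≤ clusterRadius G 𝒞 α C ∧
        conn G (X ∪ U) s z := by
    intro e he
    obtain ⟨_, ⟨s, hs, rfl⟩, hend⟩ := exists_root_of_mem_shortestPathForest C.finite_toSet he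
    refine ⟨s, hs, fun z hz => ?_⟩
    obtain ⟨X, hX, hfin, hcard, hconn⟩ := hend z hz
    exact ⟨X, hX, hfin, hcard, conn_mono G (Set.union_subset_union_right _ hU) (hconn s rfl)⟩
  obtain ⟨X, hX, -, hcard, hconn⟩ :=
    exists_subset_conn (boundary_finite G C.finite_toSet) hnear
  exact ⟨X, hX, hcard, hconn⟩

/-- The edges contracted in the clusters outside `P`. -/
def pendingEdges (G : Graph V E) (𝒞 : Set (Finset E)) (α : ℝ) (P : Finset (Finset E)) : Set E :=
  ⋃ C ∈ 𝒞 \ (P : Set (Finset E)), newEdges G 𝒞 α C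

theorem newEdges_subset_pendingEdges {P : Finset (Finset E)} {C : Finset E} (hC : C ∈ 𝒞)
    (hCP : C ∉ P) : newEdges G 𝒞 α C ⊆ pendingEdges G 𝒞 α P :=
  Set.subset_biUnion_of_mem (u := newEdges G 𝒞 α)
    (show C ∈ 𝒞 \ (P : Set (Finset E)) from ⟨hC, hCP⟩)

/-- The edge set `W` makes the clusters of `P` simple, up to the edges contracted in the remaining
clusters. -/
structure IsPartialSolution (G : Graph V E) (D : Set (Sym2 V)) (𝒞 : Set (Finset E)) (α β γ : ℝ)
    (L : (C : Finset E) → ℤ → Set (Set (CVertex G (contract G 𝒞 α C)))) (F : Set E) (w : ℕ)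
    (P : Finset (Finset E)) (W : Set E) (Z : Finset V) : Prop where
  subset : F ⊆ W
  subset_edgeSet : W ⊆ E(G)
  charging : IsCharging G F (⋃ C ∈ P, act G D C) (conn G (W ∪ pendingEdges G 𝒞 α P)) Z
  capture : ∀ C ∈ P, RegionsCapture G D 𝒞 α γ C (L C) (conn G (W ∪ pendingEdges G 𝒞 α P))
  cost : (W.ncard : ℝ) ≤ F.ncard + 2 * β * charge G F Z + ∑ C ∈ P,
    (2 * β / γ * (F ∩ C).ncard * (2 * w - 1) + 2 * clusterRadius G 𝒞 α C * (2 * w - 1))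

/-- Classes are merged while all of `B^C` is still pending; then the edges contracted at `C` itself
are dropped in favour of a small subset. Connectivity between active vertices of treated clusters
survives this exchange. -/
theorem IsPartialSolution.exists_insert [DecidableEq (Finset E)] (hG : E(G).Finite)
    (hF : IsSolution G D F) (hβ : 0 < β)
    (hγ : 1 / 2 ≤ γ) {w : ℕ} (hw : 1 ≤ w) {P : Finset (Finset E)} {C : Finset E} (hC : C ∈ 𝒞)
    (hCP : C ∉ P) (hCG : (C : Set E) ⊆ E(G)) (hwidth : (boundary G C).ncard ≤ 2 * w)
    (hne : ∀ A ∈ P, A.Nonempty) (hP : ∀ A ∈ P, Disjoint A C ∨ C ⊆ A)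
    (hL : ∀ i : ℤ, i ≤ mu G D 𝒞 α C →
      IsCovering (quotientGraph G 𝒞 α C) (quotientBoundary G 𝒞 α C) β i (L C i))
    {W : Set E} {Z : Finset V} (h : IsPartialSolution G D 𝒞 α β γ L F w P W Z) :
    ∃ W' Z', IsPartialSolution G D 𝒞 α β γ L F w (insert C P) W' Z' := by
  set U := pendingEdges G 𝒞 α P with hUdef
  set U' := pendingEdges G 𝒞 α (insert C P) with hU'def
  set K : Set V := ⋃ A ∈ insert C P, act G D A with hKdef
  -- Proper subclusters of `C` are untreated, so the children's contracted edges remain available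
  -- after `C` is treated.
  have hnotP : ∀ A ∈ 𝒞, A ⊂ C → A ∉ insert C P := by
    intro A hA hAC hAP
    rcases Finset.mem_insert.1 hAP with rfl | hAP
    · exact lt_irrefl _ hAC
    · rcases hP A hAP with hdis | hsub
      · obtain ⟨e, he⟩ := hne A hAP
        exact Finset.disjoint_left.1 hdis he (hAC.1 he)
      · exact hAC.2 hsub
  have hUU' : U ⊆ U' ∪ newEdges G 𝒞 α C := by
    refine Set.iUnion₂_subset fun A hA => ?_
    by_cases hAC : A = C
    · subst hAC
      exact Set.subset_union_right
    · refine (newEdges_subset_pendingEdges hA.1 ?_).trans Set.subset_union_left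
      simpa [hAC] using hA.2
  have hchild : childContract G 𝒞 α C ⊆ U' := childContract_subset fun A hA hAC =>
    newEdges_subset_pendingEdges hA (hnotP A hA hAC)
  have hU'U : U' ⊆ U := by
    refine Set.biUnion_subset_biUnion_left fun A hA => ⟨hA.1, fun hAP => hA.2 ?_⟩
    exact Finset.mem_insert_of_mem hAP
  have hCU : contract G 𝒞 α C ⊆ U := by
    rw [contract_eq]
    exact Set.union_subset (newEdges_subset_pendingEdges hC hCP) (hchild.trans hU'U)
  have hKsub : (⋃ A ∈ P, act G D A) ⊆ K :=
    Set.biUnion_subset_biUnion_left fun A hA => Finset.mem_insert_of_mem hA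
  have hactK : ∀ A ∈ insert C P, act G D A ⊆ K := fun A hA =>
    Set.subset_biUnion_of_mem (u := fun A : Finset E => act G D A)
      (show A ∈ ((insert C P : Finset (Finset E)) : Set (Finset E)) from hA)
  have hZK := h.charging.extend
    (fun _ _ h' => conn_mono G (h.subset.trans Set.subset_union_left) h') hKsub
  obtain ⟨W₁, Z₁, hWW₁, hW₁G, hZ₁, hcap, hcost⟩ := exists_regionsCapture hG hF hCG hβ hγ hL hCU
    (hactK C (Finset.mem_insert_self _ _)) h.subset h.subset_edgeSet hZK
  obtain ⟨X, hX, hXcard, hXconn⟩ := exists_subset_newEdges (G := G) (𝒞 := 𝒞) (α := α) (C := C)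
    (U := W₁ ∪ U') (hchild.trans Set.subset_union_right)
  have hnewC : newEdges G 𝒞 α C ⊆ C := newEdges_subset.trans Set.sdiff_subset
  have htransfer : ∀ x ∈ K, ∀ y ∈ K, conn G (W₁ ∪ U) x y → conn G (W₁ ∪ X ∪ U') x y := by
    intro x hx y hy hxy
    -- `F` moves both ends off the interior of `C`, where connectivity sees `C` only through its
    -- boundary.
    have houter : ∀ x ∈ K, ∃ o, o ∉ verts G C \ boundary G C ∧ conn G F x o := by
      intro x hx
      obtain ⟨A, hA, hxA⟩ := Set.mem_iUnion₂.1 hx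
      refine exists_outer_conn_of_mem_act hF ?_ hxA
      rcases Finset.mem_insert.1 hA with rfl | hA
      · exact Or.inr subset_rfl
      · exact (hP A hA).imp (fun h => by exact_mod_cast h) (fun h => by exact_mod_cast h)
    obtain ⟨o, ho, hxo⟩ := houter x hx
    obtain ⟨o', ho', hyo'⟩ := houter y hy
    have hFin : ∀ {s t T}, conn G F s t → conn G (W₁ ∪ T) s t := fun h' =>
      conn_mono G ((h.subset.trans hWW₁).trans Set.subset_union_left) h'
    have hsub : W₁ ∪ U ⊆ W₁ ∪ U' ∪ newEdges G 𝒞 α C := by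
      rw [Set.union_assoc]
      exact Set.union_subset_union_right _ hUU'
    have hoo := conn_of_boundary_conn hnewC hXconn ho ho'
      (conn_mono G hsub (conn_trans (conn_symm (hFin hxo)) (conn_trans hxy (hFin hyo'))))
    rw [Set.union_right_comm] at hoo
    have hFin' : ∀ {s t}, conn G F s t → conn G (W₁ ∪ X ∪ U') s t := fun h' =>
      conn_mono G (((h.subset.trans hWW₁).trans Set.subset_union_left).trans
        Set.subset_union_left) h'
    exact conn_trans (hFin' hxo) (conn_trans hoo (conn_symm (hFin' hyo')))
  refine ⟨W₁ ∪ X, Z₁, (h.subset.trans hWW₁).trans Set.subset_union_left,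
    Set.union_subset hW₁G ((hX.trans hnewC).trans hCG), hZ₁.mono htransfer, ?_, ?_⟩
  · intro A hA
    have hA' := hactK A hA
    rcases Finset.mem_insert.1 hA with rfl | hAP
    · exact hcap.mono fun x hx y hy => htransfer x (hA' hx) y (hA' hy)
    · refine (h.capture A hAP).mono fun x hx y hy hxy => htransfer x (hA' hx) y (hA' hy) ?_
      exact conn_mono G (Set.union_subset_union_left _ hWW₁) hxy
  · rw [Finset.sum_insert hCP]
    have h1 : ((W₁ ∪ X).ncard : ℝ) ≤ W₁.ncard + X.ncard := by
      exact_mod_cast Set.ncard_union_le W₁ X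
    -- For an empty boundary the truncated difference is 0, and `1 ≤ w` is what makes the bound
    -- hold.
    have hw' : (((boundary G C).ncard - 1 : ℕ) : ℝ) ≤ 2 * w - 1 := by
      have h2 : (boundary G C).ncard - 1 + 1 ≤ 2 * w := by omega
      have h3 : (((boundary G C).ncard - 1 : ℕ) : ℝ) + 1 ≤ 2 * w := by exact_mod_cast h2
      linarith
    have h2 : (X.ncard : ℝ) ≤ 2 * clusterRadius G 𝒞 α C * (2 * w - 1) := by
      refine le_trans (b := (2 * clusterRadius G 𝒞 α C * ((boundary G C).ncard - 1 : ℕ) : ℝ))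
        (by exact_mod_cast hXcard) ?_
      exact mul_le_mul_of_nonneg_left hw' (by positivity)
    have h3 : 2 * β / γ * (F ∩ C).ncard * ((boundary G C).ncard - 1 : ℕ) ≤
        2 * β / γ * (F ∩ C).ncard * (2 * w - 1) :=
      mul_le_mul_of_nonneg_left hw' (by positivity)
    have h4 := h.cost
    linarith

end TopDown

/-! ### Iterating over all clusters and double counting -/

section Structure

variable {V E : Type*} [LinearOrder E] {G : Graph V E} {D : Set (Sym2 V)} {𝒞 : Set (Finset E)}
  {α β γ : ℝ} {F : Set E}
  {L : (C : Finset E) → ℤ → Set (Set (CVertex G (contract G 𝒞 α C)))}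

theorem IsPartialSolution.empty (hF : IsSolution G D F) (w : ℕ) :
    IsPartialSolution G D 𝒞 α β γ L F w ∅ F ∅ where
  subset := subset_rfl
  subset_edgeSet := hF.1
  charging := by simpa using IsCharging.empty G F _
  capture := by simp
  cost := by simp [charge]

/-- The clusters can be made simple from the top of the decomposition to the bottom. -/
theorem exists_isPartialSolution (hG : E(G).Finite) (hF : IsSolution G D F) (hβ : 0 < β)
    (hγ : 1 / 2 ≤ γ) {w : ℕ} (hw : 1 ≤ w)
    (h𝒞 : ∀ A ∈ 𝒞, A.Nonempty ∧ (A : Set E) ⊆ E(G)) (hnc : ∀ A ∈ 𝒞, ∀ B ∈ 𝒞, Noncrossing A B)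
    (hwidth : ∀ C ∈ 𝒞, (boundary G C).ncard ≤ 2 * w)
    (hL : ∀ C ∈ 𝒞, ∀ i : ℤ, i ≤ mu G D 𝒞 α C →
      IsCovering (quotientGraph G 𝒞 α C) (quotientBoundary G 𝒞 α C) β i (L C i))
    (T : Finset (Finset E)) (hT : (T : Set (Finset E)) = 𝒞) :
    ∃ W Z, IsPartialSolution G D 𝒞 α β γ L F w T W Z := by
  classical
  have hmem : ∀ {A}, A ∈ T ↔ A ∈ 𝒞 := fun {A} => by rw [← hT]; rfl
  -- Nonincreasing cardinality, with noncrossing, makes every treated cluster contain the next one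
  -- or be disjoint from it.
  suffices main : ∀ k ≤ T.card, ∃ P ⊆ T, P.card = k ∧ (∀ A ∈ P, ∀ B ∈ T \ P, B.card ≤ A.card) ∧
      ∃ W Z, IsPartialSolution G D 𝒞 α β γ L F w P W Z by
    obtain ⟨P, hPT, hcard, -, hW⟩ := main _ le_rfl
    rwa [Finset.eq_of_subset_of_card_le hPT hcard.ge] at hW
  intro k
  induction k with
  | zero => exact fun _ => ⟨∅, by simp, rfl, by simp, F, ∅, IsPartialSolution.empty hF w⟩
  | succ k ih =>
    intro hk
    obtain ⟨P, hPT, hcard, hup, W, Z, hWZ⟩ := ih (by omega)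
    have hne : (T \ P).Nonempty := by
      rw [← Finset.card_pos, Finset.card_sdiff_of_subset hPT]
      omega
    obtain ⟨C, hC, hmax⟩ := Finset.exists_max_image (T \ P) Finset.card hne
    obtain ⟨hCT, hCP⟩ := Finset.mem_sdiff.1 hC
    refine ⟨insert C P, Finset.insert_subset hCT hPT, by rw [Finset.card_insert_of_notMem hCP,
      hcard], ?_, ?_⟩
    · intro A hA B hB
      obtain ⟨hBT, hBP⟩ := Finset.mem_sdiff.1 hB
      have hB' : B ∈ T \ P :=
        Finset.mem_sdiff.2 ⟨hBT, fun h => hBP (Finset.mem_insert_of_mem h)⟩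
      rcases Finset.mem_insert.1 hA with rfl | hA
      · exact hmax B hB'
      · exact hup A hA B hB'
    · have hC𝒞 := hmem.1 hCT
      refine hWZ.exists_insert hG hF hβ hγ hw hC𝒞 hCP (h𝒞 C hC𝒞).2 (hwidth C hC𝒞)
        (fun A hA => (h𝒞 A (hmem.1 (hPT hA))).1) (fun A hA => ?_) (hL C hC𝒞)
      rcases hnc A (hmem.1 (hPT hA)) C hC𝒞 with h | h | h
      · exact Or.inr (Finset.eq_of_subset_of_card_le h (hup A hA C hC)).ge
      · exact Or.inr h
      · exact Or.inl h

/-- Double counting of the edges of `F` in the clusters. -/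
theorem sum_ncard_inter_le (hFfin : F.Finite) (T : Finset (Finset E)) {h : ℝ}
    (hT : ∀ e ∈ F, ({C ∈ (T : Set (Finset E)) | e ∈ C}.ncard : ℝ) ≤ h) :
    ∑ C ∈ T, ((F ∩ C).ncard : ℝ) ≤ F.ncard * h := by
  classical
  obtain ⟨S, rfl⟩ := hFfin.exists_finset_coe
  have h1 : ∀ C : Finset E, ((S : Set E) ∩ C).ncard = (S.filter (· ∈ C)).card := by
    intro C
    rw [← Set.ncard_coe_finset]
    congr 1
    ext e
    simp
  have h2 : ∀ e : E, {C ∈ (T : Set (Finset E)) | e ∈ C}.ncard = (T.filter (e ∈ ·)).card := by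
    intro e
    rw [← Set.ncard_coe_finset]
    congr 1
    ext C
    simp
  simp only [h1]
  have h3 := Finset.sum_card_bipartiteAbove_eq_sum_card_bipartiteBelow (s := T) (t := S)
    (fun (C : Finset E) e => e ∈ C)
  simp only [Finset.bipartiteAbove, Finset.bipartiteBelow] at h3
  calc ∑ C ∈ T, ((S.filter (· ∈ C)).card : ℝ) = ∑ e ∈ S, ((T.filter (e ∈ ·)).card : ℝ) := by
        exact_mod_cast h3
    _ ≤ ∑ _e ∈ S, h := Finset.sum_le_sum fun e he => by rw [← h2]; exact hT e he
    _ = _ := by rw [Finset.sum_const, nsmul_eq_mul, Set.ncard_coe_finset]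

end Structure

end SteinerForest

/-! ### The final bound and the passage to a forest -/

theorem mainTheorem4 {V E : Type*} [LinearOrder E]
    (G : Graph V E) (hG : (Graph.edgeSet G).Finite)
    (D : Set (Sym2 V))
    (𝒞 : Set (Finset E)) (h𝒞 : SteinerForest.IsBranchDecomposition G 𝒞)
    (w : ℕ) (hw : 1 ≤ w)
    (hwidth : ∀ C ∈ 𝒞, (SteinerForest.boundary G C).ncard ≤ 2 * w)
    (hheight : ∀ e ∈ Graph.edgeSet G,
      ({C ∈ 𝒞 | e ∈ C}.ncard : ℝ) ≤ 3 * Real.logb 2 (Graph.edgeSet G).ncard + 1)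
    (α β γ : ℝ) (hα : 0 < α) (hβ : 0 < β) (hγ : 1 / 2 ≤ γ)
    (L : (C : Finset E) → ℤ →
      Set (Set (SteinerForest.CVertex G (SteinerForest.contract G 𝒞 α C))))
    (hL : ∀ C ∈ 𝒞, ∀ i : ℤ, i ≤ SteinerForest.mu G D 𝒞 α C →
      SteinerForest.IsCovering (SteinerForest.quotientGraph G 𝒞 α C)
        (SteinerForest.quotientBoundary G 𝒞 α C) β i (L C i))
    (F : Set E) (hF : SteinerForest.IsSolution G D F) :
    ∃ F' : Set E, F ⊆ F' ∧ SteinerForest.IsSolution G D F' ∧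
      (SteinerForest.IsForest G F → SteinerForest.IsForest G F') ∧
      (∀ C ∈ 𝒞, SteinerForest.IsSimple G D 𝒞 α γ C (L C)
        (SteinerForest.canonicalConfiguration G D F' C)) ∧
      (F'.ncard : ℝ) ≤ F.ncard
        + 4 * β * (2 * w - 1)
            * (1 + (3 * Real.logb 2 (Graph.edgeSet G).ncard + 1) / γ) * F.ncard
        + 2 * α⁻¹ * (2 * w - 1) * (Graph.edgeSet G).ncard := by
  classical
  obtain ⟨⟨h𝒞G, hnc⟩, -⟩ := h𝒞
  have hFfin : F.Finite := hG.subset hF.1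
  have h𝒞fin : 𝒞.Finite := by
    refine (Finset.finite_toSet hG.toFinset.powerset).subset fun C hC => ?_
    rw [Finset.mem_coe, Finset.mem_powerset]
    exact fun e he => hG.mem_toFinset.2 ((h𝒞G C hC).2 he)
  obtain ⟨T, rfl⟩ := h𝒞fin.exists_finset_coe
  obtain ⟨W, Z, hW⟩ := SteinerForest.exists_isPartialSolution hG hF hβ hγ hw h𝒞G hnc
    hwidth hL T rfl
  -- With every cluster treated, nothing is pending and `W` alone carries the connectivity.
  have hpend : W ∪ SteinerForest.pendingEdges G (T : Set (Finset E)) α T = W := by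
    simp [SteinerForest.pendingEdges]
  have hcap := hW.capture
  have hcharge := hW.charging.charge_le hFfin
  have hcost := hW.cost
  rw [hpend] at hcap
  set h : ℝ := 3 * Real.logb 2 (Graph.edgeSet G).ncard + 1
  have hwpos : (1 : ℝ) ≤ 2 * w - 1 := by
    have : (1 : ℝ) ≤ w := by exact_mod_cast hw
    linarith
  have hbound : (W.ncard : ℝ) ≤ F.ncard + 4 * β * (2 * w - 1) * (1 + h / γ) * F.ncard
      + 2 * α⁻¹ * (2 * w - 1) * (Graph.edgeSet G).ncard := by
    have h1 := SteinerForest.sum_ncard_inter_le hFfin T fun e he => hheight e (hF.1 he)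
    have h2 := SteinerForest.sum_clusterRadius_le hα hG (fun A hA => (h𝒞G A hA).2)
      hnc T subset_rfl
    have h0 : 0 ≤ ∑ C ∈ T, ((F ∩ C).ncard : ℝ) := Finset.sum_nonneg fun _ _ => by positivity
    have hγ0 : 0 < γ := by linarith
    -- The argument yields `2 * β / γ` here; the factor 4 is slack.
    have h3 : 2 * β / γ * (2 * w - 1) * ∑ C ∈ T, ((F ∩ C).ncard : ℝ) ≤
        4 * β / γ * (2 * w - 1) * (F.ncard * h) := by
      have h4 : 2 * β / γ * (2 * w - 1) * ∑ C ∈ T, ((F ∩ C).ncard : ℝ) ≤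
          2 * β / γ * (2 * w - 1) * (F.ncard * h) :=
        mul_le_mul_of_nonneg_left h1 (by positivity)
      have h5 : 0 ≤ 2 * β / γ * (2 * w - 1) * (F.ncard * h) :=
        mul_nonneg (by positivity) (h0.trans h1)
      calc _ ≤ _ := h4
        _ ≤ 2 * β / γ * (2 * w - 1) * (F.ncard * h) + 2 * β / γ * (2 * w - 1) * (F.ncard * h) := by
          linarith
        _ = _ := by ring
    have h6 : 2 * (2 * w - 1) *
        ∑ C ∈ T, (SteinerForest.clusterRadius G (T : Set (Finset E)) α C : ℝ) ≤
        2 * (2 * w - 1) * (α⁻¹ * (Graph.edgeSet G).ncard) :=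
      mul_le_mul_of_nonneg_left h2 (by positivity)
    -- The charge is global over all clusters, so `2 * β * F.ncard` suffices; the factor `2 * (2 * w
    -- - 1)` is slack.
    have h7 : 2 * β * (SteinerForest.charge G F Z : ℝ) ≤ 4 * β * (2 * w - 1) * F.ncard := by
      have h8 : (SteinerForest.charge G F Z : ℝ) ≤ F.ncard := by exact_mod_cast hcharge
      calc 2 * β * (SteinerForest.charge G F Z : ℝ) ≤ 2 * β * F.ncard := by gcongr
        _ ≤ 4 * β * 1 * F.ncard := by
          have : 0 ≤ β * F.ncard := by positivity
          linarith
        _ ≤ _ := by gcongr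
    calc (W.ncard : ℝ) ≤ _ := hcost
      _ = F.ncard + 2 * β * SteinerForest.charge G F Z
          + 2 * β / γ * (2 * w - 1) * ∑ C ∈ T, ((F ∩ C).ncard : ℝ)
          + 2 * (2 * w - 1) *
            ∑ C ∈ T, (SteinerForest.clusterRadius G (T : Set (Finset E)) α C : ℝ) := by
        rw [Finset.sum_add_distrib, Finset.mul_sum, Finset.mul_sum, ← add_assoc]
        congr 1
        · congr 1
          exact Finset.sum_congr rfl fun _ _ => by ring
        · exact Finset.sum_congr rfl fun _ _ => by ring
      _ ≤ F.ncard + 4 * β * (2 * w - 1) * F.ncard + 4 * β / γ * (2 * w - 1) * (F.ncard * h)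
          + 2 * (2 * w - 1) * (α⁻¹ * (Graph.edgeSet G).ncard) := by linarith
      _ = _ := by ring
  obtain ⟨F', hFF', hF'W, hforest, hconn⟩ : ∃ F', F ⊆ F' ∧ F' ⊆ W ∧
      (SteinerForest.IsForest G F → SteinerForest.IsForest G F') ∧
      SteinerForest.conn G F' = SteinerForest.conn G W := by
    by_cases hfor : SteinerForest.IsForest G F
    · obtain ⟨F', h1, h2, h3, h4⟩ := SteinerForest.exists_forest_conn_eq
        (hG.subset hW.subset_edgeSet) hW.subset hfor
      exact ⟨F', h1, h2, fun _ => h3, h4⟩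
    · exact ⟨W, hW.subset, subset_rfl, fun h => absurd h hfor, rfl⟩
  refine ⟨F', hFF', ⟨hF'W.trans hW.subset_edgeSet, fun s t hst =>
    SteinerForest.conn_mono G hFF' (hF.2 s t hst)⟩, hforest, fun C hC => ?_, ?_⟩
  -- Passing from `W` to `F'` may change the inner and outer partitions, but capture depends only on
  -- the overall connectivity, which is the same.
  · exact SteinerForest.RegionsCapture.isSimple (hconn ▸ hcap C hC)
  · refine le_trans ?_ hbound
    exact_mod_cast Set.ncard_le_ncard hF'W (hG.subset hW.subset_edgeSet)
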